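/- Let $M$ be a closed connected Riemannian manifold, $p\colon\tilde M\to M$ its universal covering and $\Gamma\cong\pi_1(M)$ the group of deck transformations. Let $G\subset GL_m(\mathbb R)$ be a real reductive linear algebraic group, taken stable under transposition, $K=G\cap O(m)$, $\mathfrak g$ its Lie algebra, $\mathfrak g=\mathfrak k\oplus\mathfrak p$ the Cartan decomposition and $N=G/K$. For $n=gK\in N$ put $[\mathfrak k]_n=\mathrm{Ad}_g\mathfrak k$, $[\mathfrak p]_n=\mathrm{Ad}_g\mathfrak p$, let $\xi\mapsto\xi^{[\mathfrak k]},\xi^{[\mathfrak p]}$ be the projections of $\mathfrak g=[\mathfrak k]_n\oplus[\mathfrak p]_n$, and let $\langle\xi,\eta\rangle_n=B(\xi,\eta^{[\mathfrak p]}-\eta^{[\mathfrak k]})$, where $B$ is a $G$-invariant symmetric bilinear form on $\mathfrak g$, invariant under the Cartan involution, positive definite on $\mathfrak p$ and negative definite on $\mathfrak k$. Let $\pi_{TN}(n,\xi)=\frac{d}{dt}\big|_{t=0}\exp(t\xi)\cdot n$ and let $\beta_N\colon T_nN\to[\mathfrak p]_n$ be its right inverse; $N$ carries the $G$-invariant metric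 making $\beta_N$ isometric, with Levi-Civita connection $\nabla$ and curvature $R^N(X,Y)Z=\nabla_Y\nabla_XZ-\nabla_X\nabla_YZ+\nabla_{[X,Y]}Z$. Let $\rho_0\colon\Gamma\to G$ be a representation, $f\colon\tilde M\to N$ a smooth harmonic $\rho_0$-equivariant map and $\beta=f^*\beta_N$; projections and the metric $\langle\cdot,\cdot\rangle$ on $\tilde M\times\mathfrak g$ at $x$ are those at $f(x)$. Let $J^2G=G\times\mathfrak g\times\mathfrak g$ with product $(g,\xi,\mu)(h,\eta,\nu)=(gh,\ \xi+\mathrm{Ad}_g\eta,\ \mu+\mathrm{Ad}_g\nu+[\xi,\mathrm{Ad}_g\eta])$, and let $\rho^{(2)}=(\rho_0,c,k)\colon\Gamma\to J^2G$ be a homomorphism lifting $\rho_0$. Let $\omega$ be the harmonic $1$-form on $M$ with values in the flat bundle $\mathrm{Ad}(\rho_0)$ representing the class of the cocycle $c$ in $H^1(\Gamma,\mathfrak g)\cong H^1(M,\mathrm{Ad}(\rho_0))$; harmonic means $d\omega=0$ and $d^*\omega=0$, where $d^*$ is the formal adjoint of the flat exterior derivative $d$ for the above metrics. Let $F,F_2\colon\tilde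 M\to\mathfrak g$ be smooth and suppose that $(F,F_2)$ is $\rho^{(2)}$-equivariant, i.e. for all $\gamma\in\Gamma$, $x\in\tilde M$, $$F(\gamma x)=\mathrm{Ad}_{\rho_0(\gamma)}F(x)+c(\gamma),\qquad F_2(\gamma x)=\mathrm{Ad}_{\rho_0(\gamma)}F_2(x)+[c(\gamma),\mathrm{Ad}_{\rho_0(\gamma)}F(x)]+k(\gamma),$$ and of harmonic type, i.e., for local orthonormal frames $\{E_j\}$, $$d^*dF=0,\qquad \sum_j\big[\omega(E_j)^{[\mathfrak p]}-\omega(E_j)^{[\mathfrak k]},\,dF(E_j)\big]+d^*\big(dF_2+[\omega,F]\big)=0.$$ Let $(v,w)$ be the second order deformation of $f$ given by $v=\pi_{TN}(f,F)$, $w=\pi_{TN}\big(f,F_2+[F^{[\mathfrak k]},F^{[\mathfrak p]}]\big)$, with energy $$E(f,v,w)(t)=\tfrac12\int_M\|df\|^2+t\int_M\langle\nabla v,df\rangle+\tfrac{t^2}2\int_M\Big(\langle\nabla w,df\rangle+\sum_j\big\langle R^N(df(E_j),v)v,df(E_j)\big\rangle+\|\nabla v\|^2\Big),$$ and put $\psi=dF_2+[\omega,F]$.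 Then the integrand of the $t^2$-term and the function $\langle\psi,\beta\rangle+\|\omega^{[\mathfrak p]}\|^2$ are $\Gamma$-invariant on $\tilde M$ and induce integrable functions on $M$, and $$\frac{\partial^2E(f,v,w)}{\partial t^2}\Big|_{t=0}=\int_M\Big(\langle\psi,\beta\rangle+\|\omega^{[\mathfrak p]}\|^2\Big)\,d\mathrm{Vol}.$$ -/

import Mathlib

open scoped Manifold ContDiff Topology Bundle
open Bundle

noncomputable section

/-! ### Linear reductive groups, their Lie algebras and second order jet groups -/

/-- The algebra of endomorphisms of the Euclidean space `ℝ^m` (real `m × m` matrices), with the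
operator norm; `star` is the transpose. -/
def Op (m : ℕ) := EuclideanSpace ℝ (Fin m) →L[ℝ] EuclideanSpace ℝ (Fin m)

instance (m : ℕ) : NormedRing (Op m) :=
  inferInstanceAs (NormedRing (EuclideanSpace ℝ (Fin m) →L[ℝ] EuclideanSpace ℝ (Fin m)))

instance (m : ℕ) : NormedAlgebra ℝ (Op m) :=
  inferInstanceAs (NormedAlgebra ℝ (EuclideanSpace ℝ (Fin m) →L[ℝ] EuclideanSpace ℝ (Fin m)))

instance (m : ℕ) : StarRing (Op m) :=
  inferInstanceAs (StarRing (EuclideanSpace ℝ (Fin m) →L[ℝ] EuclideanSpace ℝ (Fin m)))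

instance (m : ℕ) : StarModule ℝ (Op m) :=
  inferInstanceAs (StarModule ℝ (EuclideanSpace ℝ (Fin m) →L[ℝ] EuclideanSpace ℝ (Fin m)))

instance (m : ℕ) : CStarRing (Op m) :=
  inferInstanceAs (CStarRing (EuclideanSpace ℝ (Fin m) →L[ℝ] EuclideanSpace ℝ (Fin m)))

instance (m : ℕ) : FiniteDimensional ℝ (Op m) :=
  inferInstanceAs (FiniteDimensional ℝ (EuclideanSpace ℝ (Fin m) →L[ℝ] EuclideanSpace ℝ (Fin m)))

instance (m : ℕ) : CompleteSpace (Op m) := FiniteDimensional.complete ℝ (Op m)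

/-- The matrix entry `X i j`. -/
def opEntry {m : ℕ} (X : Op m) (ij : Fin m × Fin m) : ℝ :=
  (show EuclideanSpace ℝ (Fin m) →L[ℝ] EuclideanSpace ℝ (Fin m) from X)
    (EuclideanSpace.single ij.2 1) ij.1

/-- `G ⊆ GL_m(ℝ)` is a real linear algebraic group which is stable under transposition.  (Up to
conjugation every group of real points of a linear reductive group is of this form, with
maximal compact subgroup `K = G ∩ O(m)`.) -/
structure IsReductiveLinear {m : ℕ} (G : Subgroup (Op m)ˣ) : Prop where
  algebraic : ∃ P : Set (MvPolynomial (Fin m × Fin m) ℝ),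
    ∀ g : (Op m)ˣ, g ∈ G ↔ ∀ q ∈ P, MvPolynomial.eval (opEntry (g : Op m)) q = 0
  star_mem : ∀ g ∈ G, star g ∈ G

/-- The adjoint action `Ad_g ξ = g ξ g⁻¹`. -/
def Ad {m : ℕ} (g : (Op m)ˣ) (ξ : Op m) : Op m := g * ξ * (g⁻¹ : (Op m)ˣ)

/-- Velocities at the identity of smooth curves in `G`. -/
def IsVelocity {m : ℕ} (G : Subgroup (Op m)ˣ) (ξ : Op m) : Prop :=
  ∃ c : ℝ → (Op m)ˣ, (∀ t, c t ∈ G) ∧ c 0 = 1 ∧ ContDiff ℝ ∞ (fun t => (c t : Op m)) ∧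
    HasDerivAt (fun t => (c t : Op m)) ξ 0

theorem isVelocity_Ad {m : ℕ} {G : Subgroup (Op m)ˣ} {g : (Op m)ˣ} (hg : g ∈ G) {ξ : Op m}
    (h : IsVelocity G ξ) : IsVelocity G (Ad g ξ) := by
  obtain ⟨c, hc, h0, hs, hd⟩ := h
  refine ⟨fun t => g * c t * g⁻¹, fun t => G.mul_mem (G.mul_mem hg (hc t)) (G.inv_mem hg),
    by simp [h0], ?_, ?_⟩
  · simp only [Units.val_mul]
    exact (contDiff_const.mul hs).mul contDiff_const
  · simp only [Units.val_mul]
    exact (hd.const_mul (g : Op m)).mul_const _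

/-- The Lie algebra `𝔤` of `G` (with the commutator as bracket, see `lieAlg_bracket`). -/
def lieAlg {m : ℕ} (G : Subgroup (Op m)ˣ) : Submodule ℝ (Op m) where
  carrier := {ξ | IsVelocity G ξ}
  zero_mem' := ⟨fun _ => 1, fun _ => G.one_mem, rfl, contDiff_const, hasDerivAt_const _ _⟩
  add_mem' := by
    rintro ξ η ⟨c, hc, h0, hs, hd⟩ ⟨c', hc', h0', hs', hd'⟩
    refine ⟨fun t => c t * c' t, fun t => G.mul_mem (hc t) (hc' t), by simp [h0, h0'], ?_, ?_⟩
    · simp only [Units.val_mul]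
      exact hs.mul hs'
    · simp only [Units.val_mul]
      have h := hd.mul hd'
      simp only [h0, h0', Units.val_one, mul_one, one_mul] at h
      exact h
  smul_mem' := by
    rintro a ξ ⟨c, hc, h0, hs, hd⟩
    refine ⟨fun t => c (a * t), fun t => hc _, by simp [h0], ?_, ?_⟩
    · exact hs.comp (contDiff_const.mul contDiff_id)
    · have h1 : HasDerivAt (fun t : ℝ => a * t) a 0 := by
        simpa using (hasDerivAt_id (0 : ℝ)).const_mul a
      have h2 : HasDerivAt (fun t => (c t : Op m)) ξ (a * 0) := by rw [mul_zero]; exact hd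
      exact HasDerivAt.scomp (h := fun t : ℝ => a * t) (0 : ℝ) h2 h1

theorem hasDerivAt_mem {m : ℕ} (S : Submodule ℝ (Op m)) {c : ℝ → Op m} {ξ : Op m} {t₀ : ℝ}
    (hc : ∀ t, c t ∈ S) (h : HasDerivAt c ξ t₀) : ξ ∈ S := by
  obtain ⟨q, hq⟩ := S.exists_isCompl
  let P : Op m →ₗ[ℝ] q := q.projectionOnto S hq.symm
  have h1 := (LinearMap.toContinuousLinearMap P).hasFDerivAt.comp_hasDerivAt t₀ h
  have h2 : (fun t => LinearMap.toContinuousLinearMap P (c t)) = fun _ => 0 := by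
    funext t
    simpa [P] using (hc t)
  have h3 : HasDerivAt (fun t => LinearMap.toContinuousLinearMap P (c t)) 0 t₀ := by
    rw [h2]; exact hasDerivAt_const _ _
  have h4 := h1.unique h3
  simpa [P] using h4

theorem lieAlg_bracket {m : ℕ} (G : Subgroup (Op m)ˣ) {ξ η : Op m} (hξ : ξ ∈ lieAlg G)
    (hη : η ∈ lieAlg G) : ⁅ξ, η⁆ ∈ lieAlg G := by
  obtain ⟨c, hc, h0, hs, hd⟩ := hξ
  refine hasDerivAt_mem (lieAlg G) (c := fun t => Ad (c t) η) (t₀ := 0)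
    (fun t => isVelocity_Ad (hc t) hη) ?_
  have h1 : HasDerivAt (fun t => Ring.inverse (c t : Op m)) (-ξ) 0 := by
    have h := hasFDerivAt_ringInverse (𝕜 := ℝ) (c 0)
    refine (HasFDerivAt.comp_hasDerivAt (0 : ℝ) h hd).congr_deriv ?_
    simp only [h0, inv_one, Units.val_one, neg_apply,
      ContinuousLinearMap.mulLeftRight_apply, one_mul, mul_one]
  have h2 := (hd.mul_const η).mul h1
  have h3 : (fun t => Ad (c t) η)
      = (fun t => (c t : Op m) * η) * fun t => Ring.inverse (c t : Op m) := by
    funext t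
    simp only [Ad, Pi.mul_apply, Ring.inverse_unit]
  rw [h3]
  refine h2.congr_deriv ?_
  simp only [h0, Units.val_one, Ring.inverse_one, one_mul, mul_one, mul_neg, Ring.lie_def,
    sub_eq_add_neg]

/-- The second order jet group of `GL_m`, that is `GL_m(ℝ[t]/(t³))`, in right trivialization:
`(g, ξ, μ)` is the 2-jet at `t = 0` of a curve `g(t)` with `g(0) = g` for which
`g'(t) g(t)⁻¹ = ξ + t μ + O(t²)`. -/
@[ext] structure JetGL (m : ℕ) where
  base : (Op m)ˣ
  fst : Op m
  snd : Op m

theorem Ad_mul {m : ℕ} (g h : (Op m)ˣ) (ξ : Op m) : Ad (g * h) ξ = Ad g (Ad h ξ) := by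
  simp [Ad, mul_assoc]

theorem Ad_one {m : ℕ} (ξ : Op m) : Ad 1 ξ = ξ := by simp [Ad]

theorem Ad_add {m : ℕ} (g : (Op m)ˣ) (ξ η : Op m) : Ad g (ξ + η) = Ad g ξ + Ad g η := by
  simp [Ad, mul_add, add_mul]

theorem Ad_neg {m : ℕ} (g : (Op m)ˣ) (ξ : Op m) : Ad g (-ξ) = -Ad g ξ := by
  simp [Ad]

theorem Ad_lie {m : ℕ} (g : (Op m)ˣ) (ξ η : Op m) : Ad g ⁅ξ, η⁆ = ⁅Ad g ξ, Ad g η⁆ := by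
  simp only [Ad, Ring.lie_def, mul_sub, sub_mul, mul_assoc, Units.inv_mul_cancel_left]

instance {m : ℕ} : Mul (JetGL m) :=
  ⟨fun a b => ⟨a.base * b.base, a.fst + Ad a.base b.fst,
    a.snd + Ad a.base b.snd + ⁅a.fst, Ad a.base b.fst⁆⟩⟩

instance {m : ℕ} : One (JetGL m) := ⟨⟨1, 0, 0⟩⟩

instance {m : ℕ} : Inv (JetGL m) :=
  ⟨fun a => ⟨a.base⁻¹, -Ad a.base⁻¹ a.fst, -Ad a.base⁻¹ a.snd⟩⟩

theorem JetGL.mul_def {m : ℕ} (a b : JetGL m) :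
    a * b = ⟨a.base * b.base, a.fst + Ad a.base b.fst,
      a.snd + Ad a.base b.snd + ⁅a.fst, Ad a.base b.fst⁆⟩ := rfl

theorem JetGL.one_def {m : ℕ} : (1 : JetGL m) = ⟨1, 0, 0⟩ := rfl

theorem JetGL.inv_def {m : ℕ} (a : JetGL m) :
    a⁻¹ = ⟨a.base⁻¹, -Ad a.base⁻¹ a.fst, -Ad a.base⁻¹ a.snd⟩ := rfl

instance {m : ℕ} : Group (JetGL m) :=
  Group.ofLeftAxioms
    (by
      intro a b c
      ext1
      · simp [JetGL.mul_def, mul_assoc]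
      · simp [JetGL.mul_def, Ad_add, Ad_mul, add_assoc]
      · simp only [JetGL.mul_def, Ad_add, Ad_mul, Ad_lie]
        simp only [Ring.lie_def, mul_add, add_mul]
        abel)
    (by
      intro a
      ext1 <;> simp [JetGL.mul_def, JetGL.one_def, Ad_one, Ring.lie_def])
    (by
      intro a
      ext1
      · simp [JetGL.mul_def, JetGL.one_def, JetGL.inv_def]
      · simp [JetGL.mul_def, JetGL.one_def, JetGL.inv_def]
      · simp [JetGL.mul_def, JetGL.one_def, JetGL.inv_def, Ring.lie_def])

/-- The second order jet group `J²G = G × 𝔤 × 𝔤`, with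
`(g, ξ, μ)(h, η, ν) = (gh, ξ + Ad_g η, μ + Ad_g ν + [ξ, Ad_g η])`. -/
def jetGroup {m : ℕ} (G : Subgroup (Op m)ˣ) : Subgroup (JetGL m) where
  carrier := {a | a.base ∈ G ∧ a.fst ∈ lieAlg G ∧ a.snd ∈ lieAlg G}
  one_mem' := ⟨G.one_mem, (lieAlg G).zero_mem, (lieAlg G).zero_mem⟩
  mul_mem' := by
    rintro a b ⟨ha, ha1, ha2⟩ ⟨hb, hb1, hb2⟩
    have h1 : Ad a.base b.fst ∈ lieAlg G := isVelocity_Ad ha hb1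
    have h2 : Ad a.base b.snd ∈ lieAlg G := isVelocity_Ad ha hb2
    exact ⟨G.mul_mem ha hb, (lieAlg G).add_mem ha1 h1,
      (lieAlg G).add_mem ((lieAlg G).add_mem ha2 h2) (lieAlg_bracket G ha1 h1)⟩
  inv_mem' := by
    rintro a ⟨ha, ha1, ha2⟩
    exact ⟨G.inv_mem ha, (lieAlg G).neg_mem (isVelocity_Ad (G.inv_mem ha) ha1),
      (lieAlg G).neg_mem (isVelocity_Ad (G.inv_mem ha) ha2)⟩

/-! ### The symmetric space `N = G/K`

With `K = G ∩ O(m)`, the map `gK ↦ g gᵀ` identifies `N = G/K` with `{g gᵀ | g ∈ G}`, on which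
`G` acts by `n ↦ g n gᵀ`. -/

/-- The symmetric space `N = G/K`, realised as `{g gᵀ | g ∈ G}`. -/
def symSpace {m : ℕ} (G : Subgroup (Op m)ˣ) : Set (Op m) :=
  {n | ∃ g ∈ G, n = g * star (g : Op m)}

/-- The Cartan involution of `𝔤` at the point `n` is `ξ ↦ -ξ^*`, where `ξ^* = n ξᵀ n⁻¹`
is the adjoint with respect to the scalar product determined by `n`. -/
def adjAt {m : ℕ} (n ξ : Op m) : Op m := n * star ξ * Ring.inverse n

/-- Projection of `ξ` to `[𝔭]_n = Ad_g 𝔭`, the self-adjoint elements of `𝔤` at `n = g gᵀ`. -/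
def projP {m : ℕ} (n ξ : Op m) : Op m := (1 / 2 : ℝ) • (ξ + adjAt n ξ)

/-- Projection of `ξ` to `[𝔨]_n = Ad_g 𝔨`, the anti-self-adjoint elements of `𝔤` at `n`. -/
def projK {m : ℕ} (n ξ : Op m) : Op m := (1 / 2 : ℝ) • (ξ - adjAt n ξ)

/-- The fundamental vector field `π_{TN}(n, ξ) = d/dt (exp(tξ)·n)` at `t = 0`, which is
`ξ n + n ξᵀ`. -/
def piTN {m : ℕ} (n ξ : Op m) : Op m := ξ * n + n * star ξ

/-- The map `π_{J²N}(n, ξ, μ) = (π_{TN}(n, ξ), π_{TN}(n, μ + [ξ^{[𝔨]}, ξ^{[𝔭]}]))`. -/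
def piJN {m : ℕ} (n ξ μ : Op m) : Op m × Op m :=
  (piTN n ξ, piTN n (μ + ⁅projK n ξ, projP n ξ⁆))

/-- The tangent space `T_n N`. -/
def tangentN {m : ℕ} (G : Subgroup (Op m)ˣ) (n : Op m) : Set (Op m) :=
  {V | ∃ ξ ∈ lieAlg G, V = piTN n ξ}

/-- The Maurer-Cartan form `β_N` of `N`: the right inverse of `π_{TN}` with values in `[𝔭]`
(for `ξ ∈ [𝔭]_n` one has `π_{TN}(n, ξ) = 2 ξ n`). -/
def betaN {m : ℕ} (n V : Op m) : Op m := (1 / 2 : ℝ) • (V * Ring.inverse n)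

/-- `B` is, on `𝔤`, a `G`-invariant symmetric bilinear form, compatible with the Cartan
involution, such that `(ξ, η) ↦ B(ξ, ηᵀ)` is positive definite: for instance the Killing form
on the semisimple part together with an invariant form on the centre. -/
structure IsInvariantForm {m : ℕ} (G : Subgroup (Op m)ˣ) (B : LinearMap.BilinForm ℝ (Op m)) :
    Prop where
  symm : ∀ ξ ∈ lieAlg G, ∀ η ∈ lieAlg G, B ξ η = B η ξ
  invariant : ∀ g ∈ G, ∀ ξ ∈ lieAlg G, ∀ η ∈ lieAlg G, B (Ad g ξ) (Ad g η) = B ξ η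
  cartan : ∀ ξ ∈ lieAlg G, ∀ η ∈ lieAlg G, B (star ξ) (star η) = B ξ η
  pos : ∀ ξ ∈ lieAlg G, ξ ≠ 0 → 0 < B ξ (star ξ)

/-- The metric `⟨ξ, η⟩` at the point `n ∈ N` of the bundle `N × 𝔤`. -/
def metricAt {m : ℕ} (B : LinearMap.BilinForm ℝ (Op m)) (n ξ η : Op m) : ℝ := B ξ (adjAt n η)

/-- The `G`-invariant Riemannian metric of `N` for which `β_N : T_n N → [𝔭]_n` is isometric. -/
def metricN {m : ℕ} (B : LinearMap.BilinForm ℝ (Op m)) (n V W : Op m) : ℝ :=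
  metricAt B n (betaN n V) (betaN n W)

/-- The Christoffel tensor of the Levi-Civita connection of `N`:
`∇_V W = D_V W - (V n⁻¹ W + W n⁻¹ V)/2`.  It is symmetric, so `∇` is torsion free, and
`β_N (∇_V W) = D_V (β_N W) - [β_N V, β_N W]`, so `∇` is tangent to `N` and is compatible with
each `G`-invariant metric. -/
def christoffelN {m : ℕ} (n V W : Op m) : Op m :=
  -(1 / 2 : ℝ) • (V * Ring.inverse n * W + W * Ring.inverse n * V)

/-- The curvature tensor of `∇`, with the sign convention
`R(U, V)W = ∇_V ∇_U W - ∇_U ∇_V W + ∇_{[U, V]} W`, computed from the Christoffel tensor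
(`U`, `V`, `W` being extended as constant fields). -/
def curvatureN {m : ℕ} (n U V W : Op m) : Op m :=
  fderiv ℝ (fun n' => christoffelN n' U W) n V - fderiv ℝ (fun n' => christoffelN n' V W) n U
    + christoffelN n V (christoffelN n U W) - christoffelN n U (christoffelN n V W)

/-! ### The universal covering, integration, and differential forms -/

/-- `p : X → M` is the universal covering, and `Γ` its group of deck transformations (hence
`Γ ≅ π₁(M)`). -/
structure IsUniversalCovering (d : ℕ) {X M : Type*} [TopologicalSpace X]
    [ChartedSpace (EuclideanSpace ℝ (Fin d)) X] [TopologicalSpace M]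
    [ChartedSpace (EuclideanSpace ℝ (Fin d)) M] (p : X → M)
    (Γ : Type*) [Group Γ] [MulAction Γ X] : Prop where
  simplyConnected : SimplyConnectedSpace X
  covering : IsCoveringMap p
  surjective : Function.Surjective p
  localDiffeo : IsLocalDiffeomorph (𝓡 d) (𝓡 d) ∞ p
  continuous_smul : ∀ γ : Γ, Continuous fun x : X => γ • x
  map_smul : ∀ (γ : Γ) (x : X), p (γ • x) = p x
  simplyTransitive : ∀ x y : X, p x = p y → ∃! γ : Γ, γ • x = y

section Volume

variable (d : ℕ) (M : Type*) [TopologicalSpace M] [ChartedSpace (EuclideanSpace ℝ (Fin d)) M]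
  [IsManifold (𝓡 d) ∞ M] [RiemannianBundle (fun x : M => TangentSpace (𝓡 d) x)]

/-- The Riemannian density `√(det g_{ab})` at the point `y` of the chart around `i`. -/
def chartDensity {d : ℕ} {M : Type*} [TopologicalSpace M]
    [ChartedSpace (EuclideanSpace ℝ (Fin d)) M] [IsManifold (𝓡 d) ∞ M]
    [RiemannianBundle (fun x : M => TangentSpace (𝓡 d) x)]
    (i : M) (y : EuclideanSpace ℝ (Fin d)) : ℝ :=
  letI : ChartedSpace (EuclideanSpace ℝ (Fin d)) (EuclideanSpace ℝ (Fin d)) := chartedSpaceSelf _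
  let e : Fin d → TangentSpace (𝓡 d) ((extChartAt (𝓡 d) i).symm y) := fun a =>
    mfderiv 𝓘(ℝ, EuclideanSpace ℝ (Fin d)) (𝓡 d) (extChartAt (𝓡 d) i).symm y
      (EuclideanSpace.single a (1 : ℝ) : EuclideanSpace ℝ (Fin d))
  Real.sqrt (Matrix.det (Matrix.of fun a b => inner ℝ (e a) (e b)))

/-- A smooth partition of unity subordinate to the charts of `M`. -/
def chartPartition [T2Space M] [SigmaCompactSpace M] : SmoothPartitionOfUnity M (𝓡 d) M Set.univ :=
  Classical.choose (SmoothPartitionOfUnity.exists_isSubordinate_chartAt_source (𝓡 d) M)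

/-- The Riemannian volume measure: `∫ u dVol = ∑ᵢ ∫ (χᵢ u √(det g)) ∘ φᵢ⁻¹ dy` for a partition of
unity `(χᵢ)` subordinate to the charts `φᵢ`. -/
def riemannianVolume [T2Space M] [SigmaCompactSpace M] [MeasurableSpace M] :
    MeasureTheory.Measure M :=
  MeasureTheory.Measure.sum fun i : M =>
    MeasureTheory.Measure.map (extChartAt (𝓡 d) i).symm
      ((MeasureTheory.volume.restrict (extChartAt (𝓡 d) i).target).withDensity fun y =>
        ENNReal.ofReal
          (chartPartition d M i ((extChartAt (𝓡 d) i).symm y) * chartDensity i y))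

end Volume

/-- `𝔤𝔩_m`-valued 1-forms on `X`. -/
abbrev OneForm (d m : ℕ) (X : Type*) [TopologicalSpace X]
    [ChartedSpace (EuclideanSpace ℝ (Fin d)) X] :=
  ∀ x : X, TangentSpace (𝓡 d) x →L[ℝ] Op m

/-- The differential of an `Op m`-valued function. -/
def dMap (d : ℕ) {m : ℕ} {X : Type*} [TopologicalSpace X]
    [ChartedSpace (EuclideanSpace ℝ (Fin d)) X] (s : X → Op m) : OneForm d m X :=
  fun x => mfderiv (𝓡 d) 𝓘(ℝ, Op m) s x

section Cover

variable {d m : ℕ} {X M : Type*} [TopologicalSpace X]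
  [ChartedSpace (EuclideanSpace ℝ (Fin d)) X] [TopologicalSpace M]
  [ChartedSpace (EuclideanSpace ℝ (Fin d)) M] [IsManifold (𝓡 d) ∞ M]
  [RiemannianBundle (fun x : M => TangentSpace (𝓡 d) x)]

/-- The function on `M` induced by an invariant function `u` on the universal covering. -/
def descend (p : X → M) (u : X → ℝ) : M → ℝ :=
  open Classical in fun y => if h : ∃ x, p x = y then u h.choose else 0

/-- `∑ⱼ b(Eⱼ)` for an orthonormal frame `(Eⱼ)` of `T_x X`, where `X` carries the pull-back by `p`
of the metric of `M`. -/
def frameSum {A : Type*} [AddCommMonoid A] (p : X → M) (x : X)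
    (b : TangentSpace (𝓡 d) x → A) : A :=
  haveI : FiniteDimensional ℝ (TangentSpace (𝓡 d) (p x)) :=
    inferInstanceAs (FiniteDimensional ℝ (EuclideanSpace ℝ (Fin d)))
  ∑ j, b ((mfderiv (𝓡 d) (𝓡 d) p x).inverse
    (stdOrthonormalBasis ℝ (TangentSpace (𝓡 d) (p x)) j))

variable [T2Space M] [SigmaCompactSpace M] [MeasurableSpace M]

/-- `∫_M u dVol` for an invariant function `u` on the universal covering. -/
def baseIntegral (d : ℕ) [ChartedSpace (EuclideanSpace ℝ (Fin d)) M] [IsManifold (𝓡 d) ∞ M]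
    [RiemannianBundle (fun x : M => TangentSpace (𝓡 d) x)] (p : X → M) (u : X → ℝ) : ℝ :=
  ∫ y, descend p u y ∂(riemannianVolume d M)

/-- `∫_X u dVol` for a function `u` with compact support on the universal covering `X` (with the
pull-back metric): integrate over `M` the sum of `u` over the fibres. -/
def coverIntegral (d : ℕ) [ChartedSpace (EuclideanSpace ℝ (Fin d)) M] [IsManifold (𝓡 d) ∞ M]
    [RiemannianBundle (fun x : M => TangentSpace (𝓡 d) x)] (p : X → M) (u : X → ℝ) : ℝ :=
  ∫ y, (∑ᶠ x : p ⁻¹' {y}, u x) ∂(riemannianVolume d M)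

/-! ### Harmonic maps, harmonic forms, functions of harmonic type -/

/-- `f : X → N = G/K` is smooth, i.e. has local smooth lifts to `G`. -/
def IsSmoothToN (d : ℕ) [ChartedSpace (EuclideanSpace ℝ (Fin d)) X] (G : Subgroup (Op m)ˣ)
    (f : X → Op m) : Prop :=
  ∀ x₀ : X, ∃ (U : Set X) (s : X → (Op m)ˣ), IsOpen U ∧ x₀ ∈ U ∧
    ContMDiffOn (𝓡 d) 𝓘(ℝ, Op m) ∞ (fun x => (s x : Op m)) U ∧
    ∀ x ∈ U, s x ∈ G ∧ f x = s x * star (s x : Op m)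

/-- The covariant derivative `∇^N_u v` of a tangent field `v` along `f`, for the pull-back of the
Levi-Civita connection. -/
def covDeriv (f v : X → Op m) (x : X) (u : TangentSpace (𝓡 d) x) : Op m :=
  dMap d v x u + christoffelN (f x) (dMap d f x u) (v x)

/-- `f : X → N` is harmonic: `d_∇^*(df) = 0` (i.e. the tension field vanishes), where `d_∇^*` is
the formal adjoint of the covariant derivative on sections of `f^*TN`. -/
structure IsHarmonicMap (G : Subgroup (Op m)ˣ) (B : LinearMap.BilinForm ℝ (Op m)) (p : X → M)
    (f : X → Op m) : Prop where
  smooth : IsSmoothToN d G f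
  harmonic : ∀ V : X → Op m, ContMDiff (𝓡 d) 𝓘(ℝ, Op m) ∞ V → (∀ x, V x ∈ tangentN G (f x)) →
    HasCompactSupport V →
      coverIntegral d p (fun x => frameSum (d := d) p x fun e =>
        metricN B (f x) (dMap d f x e) (covDeriv (d := d) f V x e)) = 0

/-- `d^*α = η`, where `d^*` is the formal adjoint of `d` with respect to the metric of `X` and the
metric of `X × 𝔤` induced by `f`. -/
def IsCodifferential (G : Subgroup (Op m)ˣ) (B : LinearMap.BilinForm ℝ (Op m)) (p : X → M)
    (f : X → Op m) (α : OneForm d m X) (η : X → Op m) : Prop :=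
  ∀ φ : X → Op m, ContMDiff (𝓡 d) 𝓘(ℝ, Op m) ∞ φ → (∀ x, φ x ∈ lieAlg G) → HasCompactSupport φ →
    coverIntegral d p (fun x => frameSum (d := d) p x fun e =>
        metricAt B (f x) (α x e) (dMap d φ x e))
      = coverIntegral d p (fun x => metricAt B (f x) (η x) (φ x))

/-- `ω` is the harmonic 1-form on `M` with values in `Ad(ρ₀)` (i.e. an equivariant form on `X`)
which represents the class of the cocycle `c` under `H¹(M, Ad(ρ₀)) ≅ H¹(Γ, 𝔤)`: the latter
isomorphism is given by the periods `γ ↦ ∫_{x₀}^{γ x₀} ω`, expressed here by a primitive of `ω` on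
the simply connected space `X`. -/
structure IsHarmonicRepresentative {Γ : Type*} [Group Γ] [MulAction Γ X] (G : Subgroup (Op m)ˣ)
    (B : LinearMap.BilinForm ℝ (Op m)) (p : X → M) (f : X → Op m) (ρ₀ : Γ →* G) (c : Γ → Op m)
    (om : OneForm d m X) : Prop where
  equivariant : ∀ (γ : Γ) (x : X) (u : TangentSpace (𝓡 d) x),
    om (γ • x) (mfderiv (𝓡 d) (𝓡 d) (fun y : X => γ • y) x u) = Ad (ρ₀ γ) (om x u)
  represents : ∃ Φ : X → Op m, ContMDiff (𝓡 d) 𝓘(ℝ, Op m) ∞ Φ ∧ (∀ x, Φ x ∈ lieAlg G) ∧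
    dMap d Φ = om ∧
    ∀ x₀ : X, ∃ ζ ∈ lieAlg G, ∀ γ : Γ, Φ (γ • x₀) - Φ x₀ = c γ + (Ad (ρ₀ γ) ζ - ζ)
  coclosed : IsCodifferential G B p f om 0

/-- The 1-form `ψ = dF₂ + [ω, F]`, the second component of `D₂ (F, F₂) = (dF, dF₂ + [ω, F])`. -/
def psi (om : OneForm d m X) (F F₂ : X → Op m) : OneForm d m X := fun x =>
  dMap d F₂ x + ((ContinuousLinearMap.mul ℝ (Op m)).flip (F x)
    - ContinuousLinearMap.mul ℝ (Op m) (F x)).comp (om x)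

theorem psi_apply (om : OneForm d m X) (F F₂ : X → Op m) (x : X) (u : TangentSpace (𝓡 d) x) :
    psi om F F₂ x u = dMap d F₂ x u + ⁅om x u, F x⁆ := rfl

/-- The contraction `ω^* ⌟ α = ∑ⱼ [ω(Eⱼ)^*, α(Eⱼ)]`, with `ω^* = ω^{[𝔭]} - ω^{[𝔨]}`. -/
def contractAdj (p : X → M) (f : X → Op m) (om α : OneForm d m X) (x : X) : Op m :=
  frameSum (d := d) p x fun e => ⁅projP (f x) (om x e) - projK (f x) (om x e), α x e⁆

/-- `(F, F₂)` is of harmonic type: `D_{2,*} D₂ (F, F₂) = 0`, i.e.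
`d^* dF = 0` and `ω^* ⌟ dF + d^*(dF₂ + [ω, F]) = 0`. -/
structure IsHarmonicType (G : Subgroup (Op m)ˣ) (B : LinearMap.BilinForm ℝ (Op m)) (p : X → M)
    (f : X → Op m) (om : OneForm d m X) (F F₂ : X → Op m) : Prop where
  first : IsCodifferential G B p f (dMap d F) 0
  second : IsCodifferential G B p f (psi om F F₂)
    (fun x => -contractAdj p f om (dMap d F) x)

/-- `(F, F₂) : X → 𝔤 × 𝔤` is equivariant along `ρ₂ = (ρ₀, c, k) : Γ → J²G`. -/
structure IsEquivariantPair {Γ : Type*} [Group Γ] [MulAction Γ X] {G : Subgroup (Op m)ˣ}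
    (ρ₂ : Γ →* jetGroup G) (F F₂ : X → Op m) : Prop where
  first : ∀ (γ : Γ) (x : X),
    F (γ • x) = Ad (ρ₂ γ : JetGL m).base (F x) + (ρ₂ γ : JetGL m).fst
  second : ∀ (γ : Γ) (x : X),
    F₂ (γ • x) = Ad (ρ₂ γ : JetGL m).base (F₂ x)
      + ⁅(ρ₂ γ : JetGL m).fst, Ad (ρ₂ γ : JetGL m).base (F x)⁆ + (ρ₂ γ : JetGL m).snd

/-! ### The energy of a second order deformation -/

/-- The integrand of the second order term of the energy,
`⟨∇w, df⟩ + ∑ⱼ ⟨R^N(df(Eⱼ), v) v, df(Eⱼ)⟩ + ‖∇v‖²`. -/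
def secondEnergyDensity (B : LinearMap.BilinForm ℝ (Op m)) (p : X → M) (f v w : X → Op m)
    (x : X) : ℝ :=
  frameSum (d := d) p x fun e =>
    metricN B (f x) (covDeriv (d := d) f w x e) (dMap d f x e)
    + metricN B (f x) (curvatureN (f x) (dMap d f x e) (v x) (v x)) (dMap d f x e)
    + metricN B (f x) (covDeriv (d := d) f v x e) (covDeriv (d := d) f v x e)

/-- The energy `E(f, v, w)` of a second order deformation, as a polynomial function of `t`. -/
def deformationEnergy (d : ℕ) [ChartedSpace (EuclideanSpace ℝ (Fin d)) X]
    [ChartedSpace (EuclideanSpace ℝ (Fin d)) M] [IsManifold (𝓡 d) ∞ M]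
    [RiemannianBundle (fun x : M => TangentSpace (𝓡 d) x)]
    (B : LinearMap.BilinForm ℝ (Op m)) (p : X → M) (f v w : X → Op m) (t : ℝ) : ℝ :=
  1 / 2 * baseIntegral d p (fun x => frameSum (d := d) p x fun e =>
      metricN B (f x) (dMap d f x e) (dMap d f x e))
    + t * baseIntegral d p (fun x => frameSum (d := d) p x fun e =>
      metricN B (f x) (covDeriv (d := d) f v x e) (dMap d f x e))
    + t ^ 2 / 2 * baseIntegral d p (secondEnergyDensity (d := d) B p f v w)

end Cover

end

noncomputable section
/-! ### Algebra of the Cartan decomposition at a point -/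

section Cartan

variable {m : ℕ}

/-! The energy is by definition a quadratic polynomial in `t`, so its second derivative is the
integral of `secondEnergyDensity`. The content is that this density equals `⟨ψ, β⟩ + ‖ω^{[𝔭]}‖²` at
every point of the covering, and this rests on the identity `dF = ω`.

That identity is uniqueness of the harmonic representative (`dMap_eq_of_isHarmonicRepresentative`).
If `Φ` is a primitive of `ω`, then `dΦ` and `dF` are coclosed and represent the same class, so after
subtracting a constant `s = Φ - F` is `ρ₀`-equivariant. A coclosed equivariant form is orthogonal to
`ds` (`baseIntegral_pairing_eq_zero`), hence `∫ ‖ds‖² = 0` and `ds = 0`. The codifferential is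
tested only on compactly supported sections upstairs, whereas `s` is equivariant. A partition of
unity on `M` cuts `s` into pieces, each the equivariant extension of a section living on one sheet
of the covering (`exists_sheet_section`).

Once `dF = ω`, everything is read in `[𝔭]` through `β_N`. The covariant derivative of `π_{TN}(f, F)`
becomes `(dF)^{[𝔭]} - [β, F^{[𝔨]}]` (`betaN_covDeriv_piTN`), and the curvature term becomes `[[β,
F^{[𝔭]}], F^{[𝔭]}]` (`betaN_curvatureN`). The relations `[𝔨,𝔨] ⊆ 𝔨`, `[𝔨,𝔭] ⊆ 𝔭`, `[𝔭,𝔭] ⊆ 𝔨`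
simplify the `w` term (`projP_second_variation`). Ad-invariance of `B` and `[𝔨] ⊥ [𝔭]` then cancel
the terms quadratic in `F` (`density_identity`).

Invariance and integrability hold because the density is a trace of pairings of continuous
equivariant forms. Such a trace does not depend on the orthonormal frame, is continuous and
invariant, and so descends to a continuous function on a compact manifold of finite volume. -/

theorem adjAt_unit (n : (Op m)ˣ) (ξ : Op m) :
    adjAt (n : Op m) ξ = n * star ξ * ((n⁻¹ : (Op m)ˣ) : Op m) := by
  rw [adjAt, Ring.inverse_unit]

theorem adjAt_add (n ξ η : Op m) : adjAt n (ξ + η) = adjAt n ξ + adjAt n η := by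
  simp [adjAt, mul_add, add_mul]

theorem adjAt_sub (n ξ η : Op m) : adjAt n (ξ - η) = adjAt n ξ - adjAt n η := by
  simp [adjAt, mul_sub, sub_mul]

theorem adjAt_smul (n : Op m) (a : ℝ) (ξ : Op m) : adjAt n (a • ξ) = a • adjAt n ξ := by
  simp [adjAt]

theorem adjAt_adjAt {n : (Op m)ˣ} (hn : star (n : Op m) = n) (ξ : Op m) :
    adjAt (n : Op m) (adjAt (n : Op m) ξ) = ξ := by
  have h : star ((n⁻¹ : (Op m)ˣ) : Op m) = ((n⁻¹ : (Op m)ˣ) : Op m) := by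
    rw [← Units.coe_star, star_inv]
    congr 2
    exact Units.ext hn
  simp only [adjAt_unit, star_mul, star_star, hn, h]
  simp [mul_assoc]

/-- The sign appears because `ξ ↦ -adjAt n ξ`, the Cartan involution at `n`, is the Lie algebra
automorphism, while `adjAt n` reverses products. -/
theorem adjAt_lie (n : (Op m)ˣ) (ξ η : Op m) :
    adjAt (n : Op m) ⁅ξ, η⁆ = -⁅adjAt (n : Op m) ξ, adjAt (n : Op m) η⁆ := by
  simp only [adjAt_unit, Ring.lie_def, star_sub, star_mul]
  simp [mul_assoc, mul_sub, sub_mul]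

theorem projP_add_projK (n ξ : Op m) : projP n ξ + projK n ξ = ξ := by
  rw [projP, projK]; module

theorem projP_add (n ξ η : Op m) : projP n (ξ + η) = projP n ξ + projP n η := by
  simp only [projP, adjAt_add]; module

theorem projP_sub (n ξ η : Op m) : projP n (ξ - η) = projP n ξ - projP n η := by
  simp only [projP, adjAt_sub]; module

theorem projP_smul (n : Op m) (a : ℝ) (ξ : Op m) : projP n (a • ξ) = a • projP n ξ := by
  simp only [projP, adjAt_smul]; module

theorem adjAt_projP {n : (Op m)ˣ} (hn : star (n : Op m) = n) (ξ : Op m) :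
    adjAt (n : Op m) (projP n ξ) = projP n ξ := by
  rw [projP, adjAt_smul, adjAt_add, adjAt_adjAt hn, add_comm]

theorem adjAt_projK {n : (Op m)ˣ} (hn : star (n : Op m) = n) (ξ : Op m) :
    adjAt (n : Op m) (projK n ξ) = -projK n ξ := by
  rw [projK, adjAt_smul, adjAt_sub, adjAt_adjAt hn]; module

theorem piTN_eq (n : (Op m)ˣ) (ξ : Op m) : piTN (n : Op m) ξ = (2 : ℝ) • (projP n ξ * n) := by
  simp [piTN, projP, adjAt, add_mul, mul_assoc]

theorem betaN_two_smul_mul (n : (Op m)ˣ) (ξ : Op m) :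
    betaN (n : Op m) ((2 : ℝ) • (ξ * n)) = ξ := by
  simp [betaN, mul_assoc]

end Cartan

/-! ### The invariant form and the pointwise energy identity. -/

section Form

variable {m : ℕ} {G : Subgroup (Op m)ˣ} {B : LinearMap.BilinForm ℝ (Op m)}

theorem star_mem_lieAlg (hG : IsReductiveLinear G) {ξ : Op m} (h : ξ ∈ lieAlg G) :
    star ξ ∈ lieAlg G := by
  obtain ⟨c, hc, h0, hs, hd⟩ := h
  refine ⟨fun t => star (c t), fun t => hG.star_mem _ (hc t), by simp [h0], ?_, ?_⟩
  · simp only [Units.coe_star]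
    exact (starL' ℝ : Op m ≃L[ℝ] Op m).contDiff.comp hs
  · simp only [Units.coe_star]
    exact (starL' ℝ : Op m ≃L[ℝ] Op m).hasFDerivAt.comp_hasDerivAt (0 : ℝ) hd

/-- Transport to the base point: the involution at `g gᵀ` is the transpose conjugated by `Ad g`.
Facts at a general point of `N` are reduced to the base point this way. -/
theorem adjAt_eq_Ad (g : (Op m)ˣ) (ξ : Op m) :
    adjAt ((g : Op m) * star (g : Op m)) ξ = Ad g (star (Ad g⁻¹ ξ)) := by
  have h : (g : Op m) * star (g : Op m) = ((g * star g : (Op m)ˣ) : Op m) := by simp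
  rw [h, adjAt_unit]
  simp [Ad, mul_assoc]

theorem adjAt_mem (hG : IsReductiveLinear G) {n : Op m} (hn : n ∈ symSpace G) {ξ : Op m}
    (h : ξ ∈ lieAlg G) : adjAt n ξ ∈ lieAlg G := by
  obtain ⟨g, hg, rfl⟩ := hn
  rw [adjAt_eq_Ad]
  exact isVelocity_Ad hg (star_mem_lieAlg hG (isVelocity_Ad (G.inv_mem hg) h))

theorem projP_mem (hG : IsReductiveLinear G) {n : Op m} (hn : n ∈ symSpace G) {ξ : Op m}
    (h : ξ ∈ lieAlg G) : projP n ξ ∈ lieAlg G :=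
  (lieAlg G).smul_mem _ ((lieAlg G).add_mem h (adjAt_mem hG hn h))

theorem projK_mem (hG : IsReductiveLinear G) {n : Op m} (hn : n ∈ symSpace G) {ξ : Op m}
    (h : ξ ∈ lieAlg G) : projK n ξ ∈ lieAlg G :=
  (lieAlg G).smul_mem _ ((lieAlg G).sub_mem h (adjAt_mem hG hn h))

theorem exists_unit_of_mem_symSpace {n : Op m} (hn : n ∈ symSpace G) :
    ∃ u : (Op m)ˣ, (u : Op m) = n ∧ star (u : Op m) = u := by
  obtain ⟨g, hg, rfl⟩ := hn
  exact ⟨g * star g, by simp, by simp⟩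

theorem IsInvariantForm.adjAt_adjAt (hG : IsReductiveLinear G) (hB : IsInvariantForm G B)
    {n : Op m} (hn : n ∈ symSpace G) {ξ η : Op m} (hξ : ξ ∈ lieAlg G) (hη : η ∈ lieAlg G) :
    B (adjAt n ξ) (adjAt n η) = B ξ η := by
  obtain ⟨g, hg, rfl⟩ := hn
  have h1 := isVelocity_Ad (G.inv_mem hg) hξ
  have h2 := isVelocity_Ad (G.inv_mem hg) hη
  rw [adjAt_eq_Ad, adjAt_eq_Ad, hB.invariant g hg _ (star_mem_lieAlg hG h1) _
    (star_mem_lieAlg hG h2), hB.cartan _ h1 _ h2, hB.invariant _ (G.inv_mem hg) _ hξ _ hη]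

theorem metricAt_pos (hG : IsReductiveLinear G) (hB : IsInvariantForm G B)
    {n : Op m} (hn : n ∈ symSpace G) {ξ : Op m} (hξ : ξ ∈ lieAlg G) (h0 : ξ ≠ 0) :
    0 < metricAt B n ξ ξ := by
  obtain ⟨g, hg, rfl⟩ := hn
  have h1 : Ad g⁻¹ ξ ∈ lieAlg G := isVelocity_Ad (G.inv_mem hg) hξ
  have h2 : Ad g (Ad g⁻¹ ξ) = ξ := by rw [← Ad_mul]; simp [Ad_one]
  have h3 : Ad g⁻¹ ξ ≠ 0 := by
    intro h
    rw [h] at h2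
    exact h0 (by rw [← h2]; simp [Ad])
  have h4 := hB.pos _ h1 h3
  rw [metricAt, adjAt_eq_Ad]
  have h5 := hB.invariant g hg _ h1 _ (star_mem_lieAlg hG h1)
  rw [h2] at h5
  rwa [h5]

/-- Infinitesimal invariance: differentiate the constant `B (Ad (c t) η) (Ad (c t) ζ)` at `t = 0`
along a curve `c` in `G` with velocity `ξ`. -/
theorem IsInvariantForm.lie_left (hB : IsInvariantForm G B) {ξ η ζ : Op m}
    (hξ : ξ ∈ lieAlg G) (hη : η ∈ lieAlg G) (hζ : ζ ∈ lieAlg G) :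
    B ⁅ξ, η⁆ ζ = -B η ⁅ξ, ζ⁆ := by
  obtain ⟨c, hc, h0, hs, hd⟩ := hξ
  have h1 : HasDerivAt (fun t => Ring.inverse (c t : Op m)) (-ξ) 0 := by
    have h := hasFDerivAt_ringInverse (𝕜 := ℝ) (c 0)
    refine (HasFDerivAt.comp_hasDerivAt (0 : ℝ) h hd).congr_deriv ?_
    simp only [h0, inv_one, Units.val_one, neg_apply,
      ContinuousLinearMap.mulLeftRight_apply, one_mul, mul_one]
  have h2 : ∀ η : Op m, HasDerivAt (fun t => Ad (c t) η) ⁅ξ, η⁆ 0 := by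
    intro η
    have h3 : (fun t => Ad (c t) η)
        = (fun t => (c t : Op m) * η) * fun t => Ring.inverse (c t : Op m) := by
      funext t
      simp only [Ad, Pi.mul_apply, Ring.inverse_unit]
    rw [h3]
    refine ((hd.mul_const η).mul h1).congr_deriv ?_
    simp only [h0, Units.val_one, Ring.inverse_one, one_mul, mul_one, mul_neg, Ring.lie_def,
      sub_eq_add_neg]
  have h4 := (LinearMap.toContinuousBilinearMap B).hasFDerivAt_of_bilinear
    (h2 η).hasFDerivAt (h2 ζ).hasFDerivAt
  have h5 : HasDerivAt (fun t => B (Ad (c t) η) (Ad (c t) ζ))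
      (B ⁅ξ, η⁆ ζ + B η ⁅ξ, ζ⁆) 0 := by
    refine h4.hasDerivAt.congr_deriv ?_
    simp [h0, Ad_one, add_comm]
  have h6 : (fun t => B (Ad (c t) η) (Ad (c t) ζ)) = fun _ => B η ζ :=
    funext fun t => hB.invariant _ (hc t) _ hη _ hζ
  rw [h6] at h5
  linarith [h5.unique (hasDerivAt_const _ _)]

/-- `[𝔨]_n` and `[𝔭]_n` are eigenspaces, for `-1` and `1`, of the `B`-isometry `adjAt n`, hence
`B`-orthogonal. -/
theorem IsInvariantForm.eq_zero_of_adjAt (hG : IsReductiveLinear G) (hB : IsInvariantForm G B)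
    {n : Op m} (hn : n ∈ symSpace G) {κ η : Op m} (hκ : κ ∈ lieAlg G) (hη : η ∈ lieAlg G)
    (h1 : adjAt n κ = -κ) (h2 : adjAt n η = η) : B κ η = 0 := by
  have h := hB.adjAt_adjAt hG hn hκ hη
  rw [h1, h2, map_neg, LinearMap.neg_apply] at h
  linarith

/-- The second order energy density in terms of `β` and the values `τ`, `δ` of `ω`, `dF₂`. -/
theorem density_identity (hG : IsReductiveLinear G) (hB : IsInvariantForm G B)
    {n : Op m} (hn : n ∈ symSpace G) {β τ F F₂ δ : Op m} (hβ : β ∈ lieAlg G)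
    (hτ : τ ∈ lieAlg G) (hF : F ∈ lieAlg G) (hF₂ : F₂ ∈ lieAlg G) (hδ : δ ∈ lieAlg G)
    (hβn : adjAt n β = β) :
    metricAt B n (projP n δ - ⁅β, projK n F₂⁆ + ⁅projK n τ - ⁅β, projP n F⁆, projP n F⁆
        + ⁅projK n F, projP n τ - ⁅β, projK n F⁆⁆) β
      + metricAt B n ⁅⁅β, projP n F⁆, projP n F⁆ β
      + metricAt B n (projP n τ - ⁅β, projK n F⁆) (projP n τ - ⁅β, projK n F⁆)
    = metricAt B n (δ + ⁅τ, F⁆) β + metricAt B n (projP n τ) (projP n τ) := by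
  let _ : LieRing (Op m) := LieRing.ofAssociativeRing
  obtain ⟨u, hu, hus⟩ := exists_unit_of_mem_symSpace hn
  have hFp := projP_mem hG hn hF
  have hFk := projK_mem hG hn hF
  have hτp := projP_mem hG hn hτ
  have hτk := projK_mem hG hn hτ
  have hδp := projP_mem hG hn hδ
  have hδk := projK_mem hG hn hδ
  have hF₂k := projK_mem hG hn hF₂
  have aFp : adjAt n (projP n F) = projP n F := by rw [← hu]; exact adjAt_projP hus F
  have aFk : adjAt n (projK n F) = -projK n F := by rw [← hu]; exact adjAt_projK hus F
  have aτp : adjAt n (projP n τ) = projP n τ := by rw [← hu]; exact adjAt_projP hus τ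
  have aτk : adjAt n (projK n τ) = -projK n τ := by rw [← hu]; exact adjAt_projK hus τ
  have aδk : adjAt n (projK n δ) = -projK n δ := by rw [← hu]; exact adjAt_projK hus δ
  have aF₂k : adjAt n (projK n F₂) = -projK n F₂ := by rw [← hu]; exact adjAt_projK hus F₂
  have al : ∀ ξ η, adjAt n ⁅ξ, η⁆ = -⁅adjAt n ξ, adjAt n η⁆ := by
    rw [← hu]; exact adjAt_lie u
  have eδ : δ = projP n δ + projK n δ := (projP_add_projK n δ).symm
  have eτ : τ = projP n τ + projK n τ := (projP_add_projK n τ).symm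
  have eF : F = projP n F + projK n F := (projP_add_projK n F).symm
  have eL : metricAt B n (δ + ⁅τ, F⁆) β
      = metricAt B n (projP n δ + projK n δ
        + ⁅projP n τ + projK n τ, projP n F + projK n F⁆) β := by
    rw [← eδ, ← eτ, ← eF]
  rw [eL]
  -- Only the eigenvalues of `adjAt n` on these components matter from here on, so they become free
  -- elements of `𝔤`.
  generalize projP n F = Fp at *
  generalize projK n F = Fk at *
  generalize projP n τ = τp at *
  generalize projK n τ = τk at *
  generalize projP n δ = δp at *
  generalize projK n δ = δk at *
  generalize projK n F₂ = κ at *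
  have br := @lieAlg_bracket m G
  have a1 : adjAt n (τp - ⁅β, Fk⁆) = τp - ⁅β, Fk⁆ := by
    rw [adjAt_sub, al, aτp, aFk, hβn]; simp
  simp only [metricAt, a1, hβn, aτp]
  -- `z1`–`z3` kill the parts of `ψ` lying in `[𝔨]`, which are orthogonal to `β ∈ [𝔭]`.
  have z1 : B δk β = 0 := hB.eq_zero_of_adjAt hG hn hδk hβ aδk hβn
  have z2 : B ⁅τp, Fp⁆ β = 0 := hB.eq_zero_of_adjAt hG hn (br hτp hFp) hβ (by simp [*]) hβn
  have z3 : B ⁅τk, Fk⁆ β = 0 := hB.eq_zero_of_adjAt hG hn (br hτk hFk) hβ (by simp [*]) hβn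
  -- `ad κ` is skew for the symmetric form `B`, so `B ⁅κ, β⁆ β` equals its own negative.
  have z4 : B ⁅β, κ⁆ β = 0 := by
    rw [← lie_skew, map_neg, LinearMap.neg_apply, hB.lie_left hF₂k hβ hβ]
    have h := hB.lie_left hF₂k hβ hβ
    rw [hB.symm _ (br hF₂k hβ) _ hβ] at h
    linarith
  have z5 : B ⁅⁅β, Fp⁆, Fp⁆ β = -B ⁅β, Fp⁆ ⁅β, Fp⁆ := by
    rw [← lie_skew, map_neg, LinearMap.neg_apply, hB.lie_left hFp (br hβ hFp) hβ, ← lie_skew Fp β,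
      map_neg, neg_neg]
  -- This term of `∇w` cancels the square of `⁅β, Fk⁆` in `‖∇v‖²`. The double bracket with `Fp` in
  -- `∇w` cancels the curvature term.
  have z6 : B ⁅Fk, ⁅β, Fk⁆⁆ β = B ⁅β, Fk⁆ ⁅β, Fk⁆ := by
    rw [hB.lie_left hFk (br hβ hFk) hβ, ← lie_skew Fk β, map_neg, neg_neg]
  have z7 : B ⁅Fk, τp⁆ β = B τp ⁅β, Fk⁆ := by
    rw [hB.lie_left hFk hτp hβ, ← lie_skew Fk β, map_neg, neg_neg]
  have z8 : B ⁅β, Fk⁆ τp = B τp ⁅β, Fk⁆ := hB.symm _ (br hβ hFk) _ hτp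
  have z9 : B ⁅τp, Fk⁆ β = -B τp ⁅β, Fk⁆ := by
    rw [← lie_skew, map_neg, LinearMap.neg_apply, z7]
  simp only [lie_add, add_lie, lie_sub, sub_lie, map_add, map_sub, LinearMap.add_apply,
    LinearMap.sub_apply, z1, z2, z3, z4, z5, z6, z7, z8, z9]
  ring

end Form

/-! ### Derivatives of `Op m`-valued functions -/

section DirDeriv

variable {d m : ℕ} {X : Type*} [TopologicalSpace X] [ChartedSpace (EuclideanSpace ℝ (Fin d)) X]

/-- `s` is differentiable at `x`, with derivative `s'` in the direction `u`. -/
def HasDirDeriv (s : X → Op m) (x : X) (u : TangentSpace (𝓡 d) x) (s' : Op m) : Prop :=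
  ∃ L : TangentSpace (𝓡 d) x →L[ℝ] Op m, HasMFDerivAt (𝓡 d) 𝓘(ℝ, Op m) s x L ∧ L u = s'

variable {s t : X → Op m} {x : X} {u : TangentSpace (𝓡 d) x} {s' t' : Op m}

theorem HasDirDeriv.dMap_eq (h : HasDirDeriv s x u s') : dMap d s x u = s' := by
  obtain ⟨L, hL, rfl⟩ := h
  rw [dMap, hL.mfderiv]

theorem hasDirDeriv_of_mdifferentiableAt (h : MDifferentiableAt (𝓡 d) 𝓘(ℝ, Op m) s x)
    (u : TangentSpace (𝓡 d) x) : HasDirDeriv s x u (dMap d s x u) :=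
  ⟨_, h.hasMFDerivAt, rfl⟩

theorem HasDirDeriv.comp_hasFDerivAt {Φ : Op m → Op m} {Φ' : Op m →L[ℝ] Op m}
    (hΦ : HasFDerivAt Φ Φ' (s x)) (h : HasDirDeriv s x u s') :
    HasDirDeriv (fun y => Φ (s y)) x u (Φ' s') := by
  obtain ⟨L, hL, rfl⟩ := h
  exact ⟨Φ'.comp L, hΦ.hasMFDerivAt.comp x hL, rfl⟩

theorem HasDirDeriv.add (hs : HasDirDeriv s x u s') (ht : HasDirDeriv t x u t') :
    HasDirDeriv (fun y => s y + t y) x u (s' + t') := by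
  obtain ⟨L, hL, rfl⟩ := hs
  obtain ⟨L', hL', rfl⟩ := ht
  exact ⟨L + L', hL.add hL', rfl⟩

theorem HasDirDeriv.sub (hs : HasDirDeriv s x u s') (ht : HasDirDeriv t x u t') :
    HasDirDeriv (fun y => s y - t y) x u (s' - t') := by
  obtain ⟨L, hL, rfl⟩ := hs
  obtain ⟨L', hL', rfl⟩ := ht
  exact ⟨L - L', hL.sub hL', rfl⟩

theorem HasDirDeriv.const_smul (a : ℝ) (hs : HasDirDeriv s x u s') :
    HasDirDeriv (fun y => a • s y) x u (a • s') := by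
  obtain ⟨L, hL, rfl⟩ := hs
  exact ⟨a • L, hL.const_smul a, rfl⟩

theorem HasDirDeriv.mul (hs : HasDirDeriv s x u s') (ht : HasDirDeriv t x u t') :
    HasDirDeriv (fun y => s y * t y) x u (s' * t x + s x * t') := by
  obtain ⟨L, hL, rfl⟩ := hs
  obtain ⟨L', hL', rfl⟩ := ht
  exact ⟨_, hL.mul' hL', add_comm _ _⟩

theorem HasDirDeriv.transpose (hs : HasDirDeriv s x u s') :
    HasDirDeriv (fun y => star (s y)) x u (star s') :=
  hs.comp_hasFDerivAt (starL' ℝ : Op m ≃L[ℝ] Op m).hasFDerivAt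

theorem HasDirDeriv.inverse {n : (Op m)ˣ} (hn : s x = n) (hs : HasDirDeriv s x u s') :
    HasDirDeriv (fun y => Ring.inverse (s y)) x u
      (-(((n⁻¹ : (Op m)ˣ) : Op m) * s' * ((n⁻¹ : (Op m)ˣ) : Op m))) := by
  have h := hasFDerivAt_ringInverse (𝕜 := ℝ) n
  rw [← hn] at h
  exact hs.comp_hasFDerivAt h

theorem HasDirDeriv.lie (hs : HasDirDeriv s x u s') (ht : HasDirDeriv t x u t') :
    HasDirDeriv (fun y => ⁅s y, t y⁆) x u (⁅s', t x⁆ + ⁅s x, t'⁆) := by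
  have h := (hs.mul ht).sub (ht.mul hs)
  simp only [Ring.lie_def]
  convert h using 1
  abel

end DirDeriv

/-! ### Fields along a map to the symmetric space -/

section Along

variable {d m : ℕ} {X : Type*} [TopologicalSpace X] [ChartedSpace (EuclideanSpace ℝ (Fin d)) X]
variable {f F H : X → Op m} {x : X} {u : TangentSpace (𝓡 d) x} {β F' H' : Op m} {n : (Op m)ˣ}

/-- Product rule for `n Fᵀ n⁻¹` with `dn = 2βn`: the derivatives of `n` and `n⁻¹` contribute the two
halves of the commutator with `2β`. Hence the splitting `𝔤 = [𝔨] ⊕ [𝔭]` itself rotates by `β`, as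
the next two lemmas record. -/
theorem hasDirDeriv_adjAt (hn : f x = n)
    (hf : HasDirDeriv f x u ((2 : ℝ) • (β * n))) (hF : HasDirDeriv F x u F') :
    HasDirDeriv (fun y => adjAt (f y) (F y)) x u
      (adjAt (n : Op m) F' + (2 : ℝ) • ⁅β, adjAt (n : Op m) (F x)⁆) := by
  have h := (hf.mul hF.transpose).mul (hf.inverse hn)
  simp only [adjAt]
  convert h using 1
  rw [hn]
  simp [Ring.lie_def, mul_assoc, add_mul, smul_sub]
  abel

theorem hasDirDeriv_projP (hn : f x = n)
    (hf : HasDirDeriv f x u ((2 : ℝ) • (β * n))) (hF : HasDirDeriv F x u F') :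
    HasDirDeriv (fun y => projP (f y) (F y)) x u
      (projP (n : Op m) F' + ⁅β, projP (n : Op m) (F x) - projK (n : Op m) (F x)⁆) := by
  have h := (hF.add (hasDirDeriv_adjAt hn hf hF)).const_smul (1 / 2)
  unfold projP
  convert h using 1
  -- `adjAt n` is `1` on `[𝔭]` and `-1` on `[𝔨]`.
  have e : (1 / 2 : ℝ) • (F x + adjAt (n : Op m) (F x)) - projK (n : Op m) (F x)
      = adjAt (n : Op m) (F x) := by rw [projK]; module
  rw [e]
  module

theorem hasDirDeriv_projK (hn : f x = n)
    (hf : HasDirDeriv f x u ((2 : ℝ) • (β * n))) (hF : HasDirDeriv F x u F') :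
    HasDirDeriv (fun y => projK (f y) (F y)) x u
      (projK (n : Op m) F' - ⁅β, projP (n : Op m) (F x) - projK (n : Op m) (F x)⁆) := by
  have h := hF.sub (hasDirDeriv_projP hn hf hF)
  have e : ∀ n ξ : Op m, projK n ξ = ξ - projP n ξ := fun n ξ =>
    eq_sub_of_add_eq' (projP_add_projK n ξ)
  convert h using 1
  · funext y; exact e _ _
  · nth_rw 1 [e]; abel

theorem hasDirDeriv_piTN (hf : HasDirDeriv f x u ((2 : ℝ) • (β * n)))
    (hF : HasDirDeriv F x u F') :
    HasDirDeriv (fun y => piTN (f y) (F y)) x u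
      (F' * f x + F x * ((2 : ℝ) • (β * n)) + ((2 : ℝ) • (β * n) * star (F x) + f x * star F')) :=
  (hF.mul hf).add (hf.mul hF.transpose)

/-- Since `β_N ∇ = D β_N - [β, β_N]` and `β_N π_{TN}(f, F)` is the `[𝔭]`-part of `F`, the
contribution `[β, F^{[𝔭]}]` from the rotating splitting cancels and only `-[β, F^{[𝔨]}]` remains. -/
theorem betaN_covDeriv_piTN (hn : f x = n)
    (hf : HasDirDeriv f x u ((2 : ℝ) • (β * n))) (hF : HasDirDeriv F x u F') :
    betaN (n : Op m) (covDeriv (d := d) f (fun y => piTN (f y) (F y)) x u)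
      = projP (n : Op m) F' - ⁅β, projK (n : Op m) (F x)⁆ := by
  rw [covDeriv, (hasDirDeriv_piTN hf hF).dMap_eq, hf.dMap_eq, hn]
  simp only [betaN, christoffelN, piTN, projP, projK, adjAt, Ring.inverse_unit, Ring.lie_def,
    mul_add, add_mul, mul_sub, sub_mul, smul_mul_assoc, mul_smul_comm, mul_assoc,
    Units.mul_inv, mul_one]
  module

set_option synthInstance.maxHeartbeats 200000 in
-- The usual double-bracket curvature of a symmetric space, obtained here from the Christoffel
-- tensor and the derivative `-n⁻¹ V n⁻¹` of inversion.
theorem betaN_curvatureN (a b : Op m) :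
    betaN (n : Op m) (curvatureN (n : Op m) ((2 : ℝ) • (a * n)) ((2 : ℝ) • (b * n))
      ((2 : ℝ) • (b * n))) = ⁅⁅a, b⁆, b⁆ := by
  have hd : ∀ U V W : Op m, fderiv ℝ (fun n' => christoffelN n' U W) (n : Op m) V
      = (1 / 2 : ℝ) • (U * ((n⁻¹ : (Op m)ˣ) * V * (n⁻¹ : (Op m)ˣ)) * W
        + W * ((n⁻¹ : (Op m)ˣ) * V * (n⁻¹ : (Op m)ˣ)) * U) := by
    intro U V W
    have h := hasFDerivAt_ringInverse (𝕜 := ℝ) n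
    have h1 := ((ContinuousLinearMap.mulLeftRight ℝ (Op m) U W).hasFDerivAt.comp _ h).add
      ((ContinuousLinearMap.mulLeftRight ℝ (Op m) W U).hasFDerivAt.comp _ h)
    have h2 := h1.const_smul (-(1 / 2 : ℝ))
    have h3 : HasFDerivAt (fun n' => christoffelN n' U W) _ (n : Op m) := h2
    rw [h3.fderiv]
    simp
  simp only [curvatureN, hd]
  simp only [betaN, christoffelN, Ring.inverse_unit, Ring.lie_def,
    mul_add, add_mul, mul_sub, sub_mul, smul_mul_assoc, mul_smul_comm, mul_assoc,
    Units.mul_inv_cancel_left, Units.mul_inv, mul_one]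
  module

end Along

/-! ### Smooth maps into `N` and the Maurer–Cartan form. -/

section Smooth

variable {d m : ℕ} {X : Type*} [TopologicalSpace X] [ChartedSpace (EuclideanSpace ℝ (Fin d)) X]

/-- Compose with a linear map `P` whose kernel is `S`: the composite vanishes, so its derivative
does too. -/
theorem dMap_mem {S : Submodule ℝ (Op m)} {s : X → Op m} (hs : ∀ x, s x ∈ S) {x : X}
    (h : MDifferentiableAt (𝓡 d) 𝓘(ℝ, Op m) s x) (u : TangentSpace (𝓡 d) x) :
    dMap d s x u ∈ S := by
  obtain ⟨q, hq⟩ := S.exists_isCompl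
  let P : Op m →ₗ[ℝ] Op m := q.subtype ∘ₗ q.projectionOnto S hq.symm
  have hP : ∀ z, P z = 0 ↔ z ∈ S := by
    intro z
    simp [P]
  have h1 := (hasDirDeriv_of_mdifferentiableAt h u).comp_hasFDerivAt
    (LinearMap.toContinuousLinearMap P).hasFDerivAt
  have h2 : (fun y => LinearMap.toContinuousLinearMap P (s y)) = fun _ => 0 := by
    funext y
    simpa using (hP _).2 (hs y)
  have h3 := h1.dMap_eq
  rw [h2] at h3
  have h4 : dMap d (fun _ : X => (0 : Op m)) x u = 0 := by
    rw [dMap, mfderiv_const]; rfl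
  rw [h4] at h3
  exact (hP _).1 h3.symm

/-- The right logarithmic derivative of a `G`-valued map is the velocity of `s(k t) s(x)⁻¹` for a
curve `k` through `x`. `IsVelocity` asks for a smooth curve on all of `ℝ`, so `k` must never leave
the domain of `s`. -/
theorem mul_inv_mem_lieAlg [IsManifold (𝓡 d) ∞ X] {G : Subgroup (Op m)ˣ} {U : Set X}
    (hU : IsOpen U) {s : X → (Op m)ˣ}
    (hs : ContMDiffOn (𝓡 d) 𝓘(ℝ, Op m) ∞ (fun x => (s x : Op m)) U) (hG : ∀ x ∈ U, s x ∈ G)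
    {x : X} (hx : x ∈ U) (u : TangentSpace (𝓡 d) x) :
    dMap d (fun x => (s x : Op m)) x u * ((s x)⁻¹ : (Op m)ˣ) ∈ lieAlg G := by
  let φ := extChartAt (𝓡 d) x
  let u' : EuclideanSpace ℝ (Fin d) := u
  let h : EuclideanSpace ℝ (Fin d) → Op m := fun y => (s (φ.symm y) : Op m)
  let W := φ.target ∩ φ.symm ⁻¹' U
  have hW : IsOpen W := (continuousOn_extChartAt_symm (I := 𝓡 d) x).isOpen_inter_preimage
    (isOpen_extChartAt_target x) hU
  have hxW : φ x ∈ W := ⟨mem_extChartAt_target x, by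
    simpa [φ] using hx⟩
  have hh : ContDiffOn ℝ ∞ h W := by
    rw [← contMDiffOn_iff_contDiffOn]
    exact hs.comp ((contMDiffOn_extChartAt_symm x).mono Set.inter_subset_left)
      Set.inter_subset_right
  have hd : HasFDerivAt h (dMap d (fun x => (s x : Op m)) x) (φ x) := by
    have h1 := ((hs.contMDiffAt (hU.mem_nhds hx)).mdifferentiableAt (by simp)).hasMFDerivAt
    have h2 := h1.2
    rw [ModelWithCorners.Boundaryless.range_eq_univ] at h2
    have h3 : HasFDerivWithinAt h (dMap d (fun x => (s x : Op m)) x) Set.univ (φ x) := h2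
    exact hasFDerivWithinAt_univ.1 h3
  obtain ⟨r, hr, hrW⟩ := Metric.isOpen_iff.1 hW _ hxW
  -- The curve `ε sin(t/ε) u'` has velocity `u'` at `0` but stays in the ball of radius `r`. The `+
  -- 1` covers `u' = 0`.
  let ε := r / (‖u'‖ + 1)
  have hε : 0 < ε := by positivity
  have hεr : ε * ‖u'‖ < r := by
    have : ε * (‖u'‖ + 1) = r := by simp only [ε]; field_simp
    nlinarith
  let k : ℝ → EuclideanSpace ℝ (Fin d) := fun t => φ x + (ε * Real.sin (t / ε)) • u'
  have hk : ∀ t, k t ∈ W := fun t => hrW (by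
    rw [Metric.mem_ball, dist_eq_norm]
    simp only [k, add_sub_cancel_left, norm_smul, norm_mul, Real.norm_eq_abs, abs_of_pos hε]
    refine lt_of_le_of_lt ?_ hεr
    gcongr
    exact mul_le_of_le_one_right hε.le (Real.abs_sin_le_one _))
  have hk0 : k 0 = φ x := by simp [k]
  have hks : ContDiff ℝ ∞ k :=
    contDiff_const.add ((contDiff_const.mul (Real.contDiff_sin.comp
      (contDiff_id.div_const ε))).smul contDiff_const)
  have hkd : HasDerivAt k u' 0 := by
    have h1 : HasDerivAt (fun t : ℝ => t / ε) (1 / ε) 0 := (hasDerivAt_id _).div_const ε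
    have h2 := (h1.sin.const_mul ε).smul_const u'
    refine (h2.const_add (φ x)).congr_deriv ?_
    simp [hε.ne']
  have hsx : s (φ.symm (φ x)) = s x := by rw [extChartAt_to_inv (I := 𝓡 d) x]
  refine ⟨fun t => s (φ.symm (k t)) * (s x)⁻¹,
    fun t => G.mul_mem (hG _ (hk t).2) (G.inv_mem (hG _ hx)), by simp [hk0, hsx], ?_, ?_⟩
  · simp only [Units.val_mul]
    exact (hh.comp_contDiff hks hk).mul contDiff_const
  · simp only [Units.val_mul]
    rw [← hk0] at hd
    exact (hd.comp_hasDerivAt (0 : ℝ) hkd).mul_const _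

variable {G : Subgroup (Op m)ˣ} {f : X → Op m}

theorem IsSmoothToN.mem_symSpace (hf : IsSmoothToN d G f) (x : X) : f x ∈ symSpace G := by
  obtain ⟨U, s, -, hx, -, h⟩ := hf x
  exact ⟨s x, (h x hx).1, (h x hx).2⟩

theorem IsSmoothToN.contMDiff (hf : IsSmoothToN d G f) : ContMDiff (𝓡 d) 𝓘(ℝ, Op m) ∞ f := by
  intro x
  obtain ⟨U, s, hU, hx, hs, h⟩ := hf x
  have h1 := hs.contMDiffAt (hU.mem_nhds hx)
  have h2 : ContMDiffAt (𝓡 d) 𝓘(ℝ, Op m) ∞ (fun y => (s y : Op m) * star (s y : Op m)) x := by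
    have h3 : ContDiff ℝ ∞ fun z : Op m => z * star z :=
      contDiff_id.mul (starL' ℝ : Op m ≃L[ℝ] Op m).contDiff
    exact h3.contMDiff.contMDiffAt.comp x h1
  refine h2.congr_of_eventuallyEq ?_
  filter_upwards [hU.mem_nhds hx] with y hy using (h y hy).2

/-- The Maurer-Cartan form `β = f^*β_N` takes values in `[𝔭] ⊆ 𝔤`. -/
theorem IsSmoothToN.exists_beta [IsManifold (𝓡 d) ∞ X] (hG : IsReductiveLinear G)
    (hf : IsSmoothToN d G f) (x : X) (u : TangentSpace (𝓡 d) x) :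
    ∃ β ∈ lieAlg G, adjAt (f x) β = β ∧ dMap d f x u = (2 : ℝ) • (β * f x) := by
  obtain ⟨U, s, hU, hx, hs, h⟩ := hf x
  have hη := mul_inv_mem_lieAlg hU hs (fun y hy => (h y hy).1) hx u
  have hd := hasDirDeriv_of_mdifferentiableAt
    ((hs.contMDiffAt (hU.mem_nhds hx)).mdifferentiableAt (by simp)) u
  have hd2 := (hd.mul hd.transpose).dMap_eq
  have he : dMap d f x = dMap d (fun y => (s y : Op m) * star (s y : Op m)) x :=
    Filter.EventuallyEq.mfderiv_eq (by
      filter_upwards [hU.mem_nhds hx] with y hy using (h y hy).2)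
  have hsym := hf.mem_symSpace x
  obtain ⟨n, hn, hns⟩ := exists_unit_of_mem_symSpace hsym
  generalize dMap d (fun x => (s x : Op m)) x u = σ at *
  -- Differentiating `f = s sᵀ` gives `df = π_{TN}(f, σ s⁻¹)`, which depends only on the `[𝔭]`-part
  -- of `σ s⁻¹`.
  refine ⟨projP (f x) (σ * ((s x)⁻¹ : (Op m)ˣ)), projP_mem hG hsym hη, ?_, ?_⟩
  · rw [← hn]; exact adjAt_projP hns _
  · rw [he, hd2, ← hn, ← piTN_eq, piTN, hn, (h x hx).2]
    simp [mul_assoc, ← star_mul]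

end Smooth

/-! ### The second variation field and the equality of densities. -/

section Pointwise

variable {d m : ℕ}

/-- With `a, b = ±1` the factor is `0` or `1`; this encodes all three bracket relations of the
Cartan decomposition at once. -/
theorem projP_lie_of_eq {n : (Op m)ˣ} {ξ η : Op m} {a b : ℝ} (hξ : adjAt (n : Op m) ξ = a • ξ)
    (hη : adjAt (n : Op m) η = b • η) :
    projP (n : Op m) ⁅ξ, η⁆ = ((1 - a * b) / 2) • ⁅ξ, η⁆ := by
  rw [projP, adjAt_lie, hξ, hη]
  simp only [Ring.lie_def, smul_mul_assoc, mul_smul_comm]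
  module

theorem projK_eq_sub_projP (n ξ : Op m) : projK n ξ = ξ - projP n ξ :=
  eq_sub_of_add_eq' (projP_add_projK n ξ)

/-- The left side is what `betaN_covDeriv_piTN` gives for `F₂ + [F^{[𝔨]}, F^{[𝔭]}]`. The correction
lies in `[𝔭]`, so it adds nothing to the `projK` term. Of the rotation terms, `[[β, Fk], Fp]` and
`[Fk, [β, Fp]]` lie in `[𝔨]` and are projected away. -/
theorem projP_second_variation {n : (Op m)ˣ} (hn : star (n : Op m) = n) {β τ F F₂ δ : Op m}
    (hβ : adjAt (n : Op m) β = β) :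
    projP (n : Op m) (δ + (⁅projK n τ - ⁅β, projP n F - projK n F⁆, projP n F⁆
        + ⁅projK n F, projP n τ + ⁅β, projP n F - projK n F⁆⁆))
      - ⁅β, projK n (F₂ + ⁅projK n F, projP n F⁆)⁆
    = projP n δ - ⁅β, projK n F₂⁆ + ⁅projK n τ - ⁅β, projP n F⁆, projP n F⁆
        + ⁅projK n F, projP n τ - ⁅β, projK n F⁆⁆ := by
  let _ : LieRing (Op m) := LieRing.ofAssociativeRing
  have aFp : adjAt (n : Op m) (projP n F) = (1 : ℝ) • projP n F := by
    rw [one_smul, adjAt_projP hn F]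
  have aFk : adjAt (n : Op m) (projK n F) = (-1 : ℝ) • projK n F := by
    rw [neg_one_smul, adjAt_projK hn F]
  have aτp : adjAt (n : Op m) (projP n τ) = (1 : ℝ) • projP n τ := by
    rw [one_smul, adjAt_projP hn τ]
  have aτk : adjAt (n : Op m) (projK n τ) = (-1 : ℝ) • projK n τ := by
    rw [neg_one_smul, adjAt_projK hn τ]
  have aβ : adjAt (n : Op m) β = (1 : ℝ) • β := by rw [one_smul, hβ]
  rw [projK_eq_sub_projP _ (F₂ + _), projP_add _ F₂, projK_eq_sub_projP _ F₂]
  generalize projP (n : Op m) F = Fp at *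
  generalize projK (n : Op m) F = Fk at *
  generalize projP (n : Op m) τ = τp at *
  generalize projK (n : Op m) τ = τk at *
  have aβp : adjAt (n : Op m) ⁅β, Fp⁆ = (-1 : ℝ) • ⁅β, Fp⁆ := by
    rw [adjAt_lie, aβ, aFp]; simp
  have aβk : adjAt (n : Op m) ⁅β, Fk⁆ = (1 : ℝ) • ⁅β, Fk⁆ := by
    rw [adjAt_lie, aβ, aFk]; simp
  simp only [lie_add, lie_sub, sub_lie, projP_add, projP_sub, projP_lie_of_eq aτk aFp,
    projP_lie_of_eq aβp aFp, projP_lie_of_eq aβk aFp, projP_lie_of_eq aFk aτp,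
    projP_lie_of_eq aFk aβp, projP_lie_of_eq aFk aβk, projP_lie_of_eq aFk aFp]
  rw [show ((1 - -1 * 1) / 2 : ℝ) = 1 by norm_num, one_smul ℝ ⁅Fk, Fp⁆]
  module

variable {X : Type*} [TopologicalSpace X] [ChartedSpace (EuclideanSpace ℝ (Fin d)) X]
  [IsManifold (𝓡 d) ∞ X]

/-- If `dF = ω`, the second order energy density agrees with `⟨ψ, β⟩ + ‖ω^{[𝔭]}‖²`. -/
theorem second_density_eq {G : Subgroup (Op m)ˣ} (hG : IsReductiveLinear G)
    {B : LinearMap.BilinForm ℝ (Op m)} (hB : IsInvariantForm G B) {f : X → Op m}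
    (hf : IsSmoothToN d G f) {om : OneForm d m X} {F F₂ : X → Op m}
    (hF : ContMDiff (𝓡 d) 𝓘(ℝ, Op m) ∞ F) (hF₂ : ContMDiff (𝓡 d) 𝓘(ℝ, Op m) ∞ F₂)
    (hFg : ∀ x, F x ∈ lieAlg G) (hF₂g : ∀ x, F₂ x ∈ lieAlg G) (hom : dMap d F = om)
    {v w : X → Op m} (hvw : ∀ x, (v x, w x) = piJN (f x) (F x) (F₂ x)) (x : X)
    (e : TangentSpace (𝓡 d) x) :
    metricN B (f x) (covDeriv (d := d) f w x e) (dMap d f x e)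
      + metricN B (f x) (curvatureN (f x) (dMap d f x e) (v x) (v x)) (dMap d f x e)
      + metricN B (f x) (covDeriv (d := d) f v x e) (covDeriv (d := d) f v x e)
    = metricAt B (f x) (psi om F F₂ x e) (betaN (f x) (dMap d f x e))
      + metricAt B (f x) (projP (f x) (om x e)) (projP (f x) (om x e)) := by
  obtain ⟨β, hβ, hβn, hdf⟩ := hf.exists_beta hG x e
  obtain ⟨n, hn, hns⟩ := exists_unit_of_mem_symSpace (hf.mem_symSpace x)
  have hv : v = fun y => piTN (f y) (F y) := funext fun y => congrArg Prod.fst (hvw y)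
  have hw : w = fun y => piTN (f y) (F₂ y + ⁅projK (f y) (F y), projP (f y) (F y)⁆) :=
    funext fun y => congrArg Prod.snd (hvw y)
  have dF := hasDirDeriv_of_mdifferentiableAt (hF.contMDiffAt.mdifferentiableAt (by simp)) e
  have dF₂ := hasDirDeriv_of_mdifferentiableAt (hF₂.contMDiffAt.mdifferentiableAt (by simp)) e
  have df := hasDirDeriv_of_mdifferentiableAt
    (hf.contMDiff.contMDiffAt.mdifferentiableAt (by simp)) e
  rw [hdf, ← hn] at df
  have hτ : om x e ∈ lieAlg G := by
    rw [← hom]; exact dMap_mem hFg (hF.contMDiffAt.mdifferentiableAt (by simp)) e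
  have hδ := dMap_mem hF₂g (hF₂.contMDiffAt.mdifferentiableAt (by simp)) e
  rw [hom] at dF
  have dH := dF₂.add ((hasDirDeriv_projK hn.symm df dF).lie (hasDirDeriv_projP hn.symm df dF))
  have bv := betaN_covDeriv_piTN hn.symm df dF
  have bw := betaN_covDeriv_piTN hn.symm df dH
  simp only [← hn] at bw bv
  rw [← hn] at hβn
  rw [projP_second_variation hns hβn] at bw
  have bvx : v x = (2 : ℝ) • (projP (n : Op m) (F x) * n) := by
    rw [hv]; simp only [← hn, piTN_eq]
  simp only [metricN]
  rw [psi_apply, hdf, bvx, ← hn, betaN_curvatureN, betaN_two_smul_mul, hv, hw, bv, bw]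
  have hs := hf.mem_symSpace x
  rw [← hn] at hs
  exact density_identity hG hB hs hβ hτ (hFg x) (hF₂g x) hδ hβn

end Pointwise

/-! ### Traces with respect to frames -/

/-- The trace formula `g^{ij} Q(e_i, e_j)`. The orthonormal bases in `frameSum` are chosen pointwise
with no continuity; this rewrites the sum in any basis, in particular a continuous local frame. -/
theorem sum_orthonormalBasis_eq_sum_gram {V ι κ : Type*} [NormedAddCommGroup V]
    [InnerProductSpace ℝ V] [Fintype ι] [DecidableEq ι] [Fintype κ] (e : Module.Basis ι ℝ V)
    (b : OrthonormalBasis κ ℝ V) (Q : V →ₗ[ℝ] V →ₗ[ℝ] ℝ) :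
    ∑ k, Q (b k) (b k) = ∑ i, ∑ j, (Matrix.gram ℝ e)⁻¹ i j * Q (e i) (e j) := by
  classical
  let A := e.toMatrix b
  let C := b.toBasis.toMatrix e
  have hC : ∀ k i, C k i = inner ℝ (b k) (e i) := fun k i => by
    simp [C, Module.Basis.toMatrix_apply, OrthonormalBasis.repr_apply_apply]
  have hg : C.transpose * C = Matrix.gram ℝ e := by
    ext i j
    simp only [Matrix.mul_apply, Matrix.transpose_apply, hC, Matrix.gram_apply]
    rw [← b.sum_inner_mul_inner (e i) (e j)]
    exact Finset.sum_congr rfl fun k _ => by rw [real_inner_comm]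
  have hAC : A * C = 1 := by
    simpa [A, C] using e.toMatrix_mul_toMatrix_flip b.toBasis
  have hCA : C * A = 1 := by
    simpa [A, C] using b.toBasis.toMatrix_mul_toMatrix_flip e
  -- `A` and `C` are mutually inverse changes of basis, and the Gram matrix is `CᵀC`.
  have hinv : (Matrix.gram ℝ e)⁻¹ = A * A.transpose := by
    refine Matrix.inv_eq_right_inv ?_
    rw [← hg, Matrix.mul_assoc, ← Matrix.mul_assoc C, hCA, Matrix.one_mul,
      ← Matrix.transpose_mul, hAC, Matrix.transpose_one]
  have hb : ∀ k, b k = ∑ i, A i k • e i := fun k => (e.sum_repr (b k)).symm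
  calc ∑ k, Q (b k) (b k) = ∑ k, ∑ i, ∑ j, A i k * (A j k * Q (e i) (e j)) := by
        refine Finset.sum_congr rfl fun k _ => ?_
        rw [hb k]
        simp only [map_sum, map_smul, LinearMap.sum_apply, LinearMap.smul_apply, smul_eq_mul,
          Finset.mul_sum]
        rw [Finset.sum_comm]
        exact Finset.sum_congr rfl fun i _ => Finset.sum_congr rfl fun j _ => by ring
    _ = _ := by
        rw [Finset.sum_comm]
        refine Finset.sum_congr rfl fun i _ => ?_
        rw [Finset.sum_comm]
        refine Finset.sum_congr rfl fun j _ => ?_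
        rw [hinv, Matrix.mul_apply, Finset.sum_mul]
        exact Finset.sum_congr rfl fun k _ => by rw [Matrix.transpose_apply]; ring

section Frame

variable {d m : ℕ} {X M : Type*} [TopologicalSpace X]
  [ChartedSpace (EuclideanSpace ℝ (Fin d)) X] [TopologicalSpace M]
  [ChartedSpace (EuclideanSpace ℝ (Fin d)) M]
  [RiemannianBundle (fun x : M => TangentSpace (𝓡 d) x)]

theorem frameSum_eq_sum_gram {p : X → M} {x : X} (hp : IsLocalDiffeomorphAt (𝓡 d) (𝓡 d) ∞ p x)
    {ι : Type*} [Fintype ι] [DecidableEq ι] (e : Module.Basis ι ℝ (TangentSpace (𝓡 d) x))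
    (Q : TangentSpace (𝓡 d) x →ₗ[ℝ] TangentSpace (𝓡 d) x →ₗ[ℝ] ℝ) :
    frameSum (d := d) p x (fun u => Q u u)
      = ∑ i, ∑ j, (Matrix.gram ℝ fun i =>
          (mfderiv (𝓡 d) (𝓡 d) p x (e i) : TangentSpace (𝓡 d) (p x)))⁻¹ i j
            * Q (e i) (e j) := by
  let D := hp.mfderivToContinuousLinearEquiv (by simp)
  have hD : mfderiv (𝓡 d) (𝓡 d) p x = D := rfl
  have hi : (mfderiv (𝓡 d) (𝓡 d) p x).inverse = D.symm := by
    rw [hD, ContinuousLinearMap.inverse_equiv]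
  let D' : TangentSpace (𝓡 d) (p x) →ₗ[ℝ] TangentSpace (𝓡 d) x := D.symm.toLinearEquiv
  have : FiniteDimensional ℝ (TangentSpace (𝓡 d) (p x)) :=
    inferInstanceAs (FiniteDimensional ℝ (EuclideanSpace ℝ (Fin d)))
  have h := sum_orthonormalBasis_eq_sum_gram (e.map D.toLinearEquiv)
    (stdOrthonormalBasis ℝ (TangentSpace (𝓡 d) (p x))) (Q.compl₁₂ D' D')
  have h1 : frameSum (d := d) p x (fun u => Q u u)
      = ∑ k, (Q.compl₁₂ D' D') (stdOrthonormalBasis ℝ (TangentSpace (𝓡 d) (p x)) k)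
        (stdOrthonormalBasis ℝ (TangentSpace (𝓡 d) (p x)) k) := by
    rw [frameSum, hi]
    rfl
  rw [h1, h]
  refine Finset.sum_congr rfl fun i _ => Finset.sum_congr rfl fun j _ => ?_
  have h2 : ∀ i, D' (e.map D.toLinearEquiv i) = e i := fun i => by
    simp [D']
  rw [LinearMap.compl₁₂_apply, h2, h2]
  rfl

end Frame

/-! ### Continuous and equivariant forms -/

section ContinuousForm

variable {d m : ℕ} {X : Type*} [TopologicalSpace X]
  [ChartedSpace (EuclideanSpace ℝ (Fin d)) X] [IsManifold (𝓡 d) ∞ X]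

/-- The coordinate frame of `TX` determined by the trivialization at `x₀`. -/
def coordFrame (x₀ : X) (i : Fin d) (x : X) : TangentSpace (𝓡 d) x :=
  haveI : IsManifold (𝓡 d) 1 X := IsManifold.of_le (n := ∞) (by simp)
  (trivializationAt (EuclideanSpace ℝ (Fin d)) (TangentSpace (𝓡 d)) x₀).localFrame
    (EuclideanSpace.basisFun (Fin d) ℝ).toBasis i x

theorem exists_basis_eq_coordFrame (x₀ : X) :
    ∀ᶠ x in 𝓝 x₀, ∃ e : Module.Basis (Fin d) ℝ (TangentSpace (𝓡 d) x),
      ∀ i, e i = coordFrame x₀ i x := by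
  have : IsManifold (𝓡 d) 1 X := IsManifold.of_le (n := ∞) (by simp)
  let t := trivializationAt (EuclideanSpace ℝ (Fin d)) (TangentSpace (𝓡 d) : X → Type _) x₀
  filter_upwards [t.open_baseSet.mem_nhds
    (FiberBundle.mem_baseSet_trivializationAt (EuclideanSpace ℝ (Fin d)) (TangentSpace (𝓡 d)) x₀)]
    with x hx
  exact ⟨t.basisAt (EuclideanSpace.basisFun (Fin d) ℝ).toBasis hx, fun i =>
    (t.localFrame_apply_of_mem_baseSet _ hx).symm⟩

theorem contMDiffAt_coordFrame (x₀ : X) (i : Fin d) :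
    ContMDiffAt (𝓡 d) ((𝓡 d).tangent) 0
      (fun x => (⟨x, coordFrame x₀ i x⟩ : TangentBundle (𝓡 d) X)) x₀ := by
  have : IsManifold (𝓡 d) 1 X := IsManifold.of_le (n := ∞) (by simp)
  exact contMDiffAt_localFrame_of_mem 0 _ _ i
    (FiberBundle.mem_baseSet_trivializationAt (EuclideanSpace ℝ (Fin d)) (TangentSpace (𝓡 d)) x₀)

/-- `A` is a continuous 1-form: it is linear at each point and continuous on coordinate frames. -/
def IsContinuousForm (A : ∀ x : X, TangentSpace (𝓡 d) x → Op m) : Prop :=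
  (∀ x, IsLinearMap ℝ (A x)) ∧
    ∀ x₀ i, ContinuousAt (fun x => A x (coordFrame x₀ i x)) x₀

theorem isContinuousForm_dMap {s : X → Op m} (hs : ContMDiff (𝓡 d) 𝓘(ℝ, Op m) ∞ s) :
    IsContinuousForm (d := d) fun x u => dMap d s x u := by
  have : IsManifold (𝓡 d) 1 X := IsManifold.of_le (n := ∞) (by simp)
  refine ⟨fun x => (dMap d s x).toLinearMap.isLinear, fun x₀ i => ?_⟩
  have h1 := hs.contMDiff_tangentMap (m := 0) (by simp)
  have h2 := (contMDiff_snd_tangentBundle_modelSpace (n := 0) (Op m) 𝓘(ℝ, Op m)).comp h1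
  exact (h2.contMDiffAt.comp x₀ (contMDiffAt_coordFrame x₀ i)).continuousAt

theorem IsContinuousForm.map {A : ∀ x : X, TangentSpace (𝓡 d) x → Op m}
    (hA : IsContinuousForm A) {T : X → Op m → Op m} (hT : ∀ x, IsLinearMap ℝ (T x))
    (hc : ContinuousOn (fun z : X × Op m => T z.1 z.2) Set.univ) :
    IsContinuousForm fun x u => T x (A x u) := by
  refine ⟨fun x => ((hT x).mk'.comp (hA.1 x).mk').isLinear, fun x₀ i => ?_⟩
  exact (continuousOn_univ.1 hc).continuousAt.comp (continuousAt_id.prodMk (hA.2 x₀ i))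

theorem IsContinuousForm.add {A A' : ∀ x : X, TangentSpace (𝓡 d) x → Op m}
    (hA : IsContinuousForm A) (hA' : IsContinuousForm A') :
    IsContinuousForm fun x u => A x u + A' x u :=
  ⟨fun x => ((hA.1 x).mk' + (hA'.1 x).mk').isLinear, fun x₀ i => (hA.2 x₀ i).add (hA'.2 x₀ i)⟩

variable {M : Type*} [TopologicalSpace M]
  [ChartedSpace (EuclideanSpace ℝ (Fin d)) M] [IsManifold (𝓡 d) ∞ M]
  [RiemannianBundle (fun x : M => TangentSpace (𝓡 d) x)]

theorem continuousAt_gram_coordFrame [IsContMDiffRiemannianBundle (𝓡 d) ∞ (EuclideanSpace ℝ (Fin d))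
      (fun x : M => TangentSpace (𝓡 d) x)] {p : X → M}
    (hp : ContMDiff (𝓡 d) (𝓡 d) ∞ p) (x₀ : X) :
    ContinuousAt (fun x => Matrix.gram ℝ fun i =>
      (mfderiv (𝓡 d) (𝓡 d) p x (coordFrame x₀ i x) : TangentSpace (𝓡 d) (p x))) x₀ := by
  have : IsManifold (𝓡 d) 1 X := IsManifold.of_le (n := ∞) (by simp)
  have : IsManifold (𝓡 d) 1 M := IsManifold.of_le (n := ∞) (by simp)
  have : IsContMDiffRiemannianBundle (𝓡 d) 0 (EuclideanSpace ℝ (Fin d))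
      (fun x : M => TangentSpace (𝓡 d) x) := IsContMDiffRiemannianBundle.of_le (n := ∞) (by simp)
  have h1 := hp.contMDiff_tangentMap (m := 0) (by simp)
  have h2 : ∀ i, ContMDiffAt (𝓡 d) ((𝓡 d).tangent) 0 (fun x =>
      (⟨p x, mfderiv (𝓡 d) (𝓡 d) p x (coordFrame x₀ i x)⟩ : TangentBundle (𝓡 d) M)) x₀ :=
    fun i => h1.contMDiffAt.comp x₀ (contMDiffAt_coordFrame x₀ i)
  refine continuousAt_pi.2 fun i => continuousAt_pi.2 fun j => ?_
  have h3 := ContMDiffAt.inner_bundle (IB := 𝓡 d) (F := EuclideanSpace ℝ (Fin d))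
    (E := fun x : M => TangentSpace (𝓡 d) x) (b := p) (h2 i) (h2 j)
  exact h3.continuousAt

theorem continuous_metricAt (B : LinearMap.BilinForm ℝ (Op m)) {Y : Type*} [TopologicalSpace Y]
    {n ξ η : Y → Op m} {y : Y} (hn : ContinuousAt n y) (hu : IsUnit (n y)) (hξ : ContinuousAt ξ y)
    (hη : ContinuousAt η y) : ContinuousAt (fun z => metricAt B (n z) (ξ z) (η z)) y := by
  obtain ⟨u, hu⟩ := hu
  have h1 : ContinuousAt (fun z => Ring.inverse (n z)) y := by
    have h := NormedRing.inverse_continuousAt u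
    rw [hu] at h
    exact h.comp hn
  have h2 : ContinuousAt (fun z => adjAt (n z) (η z)) y := (hn.mul hη.star).mul h1
  have h3 : Continuous fun z : Op m × Op m => B z.1 z.2 :=
    (LinearMap.toContinuousBilinearMap B).continuous₂
  exact h3.continuousAt.comp (hξ.prodMk h2)

/-- Near `x₀` the frame sum is a contraction with the inverse Gram matrix of the coordinate frame,
whose entries are continuous because the Gram determinant is nonzero at `x₀`. -/
theorem continuous_frameSum_metricAt [IsContMDiffRiemannianBundle (𝓡 d) ∞
      (EuclideanSpace ℝ (Fin d)) (fun x : M => TangentSpace (𝓡 d) x)] {p : X → M}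
    (hp : IsLocalDiffeomorph (𝓡 d) (𝓡 d) ∞ p) (B : LinearMap.BilinForm ℝ (Op m))
    {f : X → Op m} (hf : Continuous f) (hu : ∀ x, IsUnit (f x))
    {A A' : ∀ x : X, TangentSpace (𝓡 d) x → Op m} (hA : IsContinuousForm A)
    (hA' : IsContinuousForm A') :
    Continuous fun x => frameSum (d := d) p x fun u => metricAt B (f x) (A x u) (A' x u) := by
  refine continuous_iff_continuousAt.2 fun x₀ => ?_
  let g : X → Matrix (Fin d) (Fin d) ℝ := fun x => Matrix.gram ℝ fun i =>
      (mfderiv (𝓡 d) (𝓡 d) p x (coordFrame x₀ i x) : TangentSpace (𝓡 d) (p x))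
  have hg : ContinuousAt g x₀ := continuousAt_gram_coordFrame hp.contMDiff x₀
  have hdet : (g x₀).det ≠ 0 := by
    obtain ⟨e, he⟩ := (exists_basis_eq_coordFrame (d := d) x₀).self_of_nhds
    let D := (hp x₀).mfderivToContinuousLinearEquiv (by simp)
    have h1 := (e.map D.toLinearEquiv).linearIndependent
    have h2 : (fun i => (mfderiv (𝓡 d) (𝓡 d) p x₀ (coordFrame x₀ i x₀) :
        TangentSpace (𝓡 d) (p x₀))) = e.map D.toLinearEquiv := by
      funext i
      rw [← he]
      rfl
    have h3 := (Matrix.posDef_gram_iff_linearIndependent (𝕜 := ℝ)).2 h1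
    simp only [g, h2]
    exact h3.det_pos.ne'
  have hinv : ContinuousAt (fun x => (g x)⁻¹) x₀ := by
    simp only [Matrix.inv_def]
    refine ContinuousAt.fun_smul ?_ ?_
    · simp only [Ring.inverse_eq_inv']
      exact (continuous_id.matrix_det.continuousAt.comp hg).inv₀ hdet
    · exact continuous_id.matrix_adjugate.continuousAt.comp hg
  have hsum : ContinuousAt (fun x => ∑ i, ∑ j, (g x)⁻¹ i j *
      metricAt B (f x) (A x (coordFrame x₀ i x)) (A' x (coordFrame x₀ j x))) x₀ := by
    refine tendsto_finsetSum _ fun i _ => tendsto_finsetSum _ fun j _ => ?_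
    refine ContinuousAt.mul ?_ ?_
    · exact continuousAt_pi.1 (continuousAt_pi.1 hinv i) j
    · exact continuous_metricAt B hf.continuousAt (hu x₀) (hA.2 x₀ i) (hA'.2 x₀ j)
  refine hsum.congr ?_
  filter_upwards [exists_basis_eq_coordFrame (d := d) x₀] with x hx
  obtain ⟨e, he⟩ := hx
  let adj : Op m →ₗ[ℝ] Op m :=
    { toFun := adjAt (f x), map_add' := adjAt_add (f x), map_smul' := adjAt_smul (f x) }
  have h := frameSum_eq_sum_gram (hp x) e
    (LinearMap.compl₁₂ B (hA.1 x).mk' (adj ∘ₗ (hA'.1 x).mk'))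
  simp only [he] at h
  exact h.symm

end ContinuousForm

/-! ### Deck transformations -/

section Deck

variable {d m : ℕ} {X M Γ : Type*} [TopologicalSpace X]
  [ChartedSpace (EuclideanSpace ℝ (Fin d)) X] [TopologicalSpace M]
  [ChartedSpace (EuclideanSpace ℝ (Fin d)) M] [Group Γ] [MulAction Γ X] {p : X → M}

/-- Deck transformations are only assumed continuous; locally `γ` is `p` followed by the inverse of
`p` on the sheet through `γ • x`. -/
theorem IsUniversalCovering.mdifferentiableAt_smul (hp : IsUniversalCovering d p Γ) (γ : Γ)
    (x : X) : MDifferentiableAt (𝓡 d) (𝓡 d) (fun y : X => γ • y) x := by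
  obtain ⟨Φ, hx, hΦ⟩ := hp.localDiffeo (γ • x)
  have h1 : MDifferentiableAt (𝓡 d) (𝓡 d) Φ.symm (p x) := by
    refine Φ.symm.mdifferentiableAt (by simp) ?_
    have : p x = Φ (γ • x) := by rw [← hΦ hx, hp.map_smul]
    rw [this]
    exact Φ.toPartialEquiv.map_source hx
  have h2 := h1.comp x ((hp.localDiffeo x).mdifferentiableAt (by simp))
  refine h2.congr_of_eventuallyEq ?_
  filter_upwards [(hp.continuous_smul γ).continuousAt.preimage_mem_nhds (Φ.open_source.mem_nhds hx)]
    with y hy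
  have h3 : p y = Φ (γ • y) := by rw [← hΦ hy, hp.map_smul]
  rw [Function.comp_apply, h3]
  exact (Φ.toPartialEquiv.left_inv hy).symm

theorem IsUniversalCovering.mfderiv_comp_smul (hp : IsUniversalCovering d p Γ) (γ : Γ) (x : X)
    (u : TangentSpace (𝓡 d) x) :
    (mfderiv (𝓡 d) (𝓡 d) p (γ • x) (mfderiv (𝓡 d) (𝓡 d) (fun y : X => γ • y) x u) :
      EuclideanSpace ℝ (Fin d)) = mfderiv (𝓡 d) (𝓡 d) p x u := by
  have h1 := mfderiv_comp x ((hp.localDiffeo (γ • x)).mdifferentiableAt (by simp))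
    (hp.mdifferentiableAt_smul γ x)
  have h2 : p ∘ (fun y : X => γ • y) = p := funext fun y => hp.map_smul γ y
  rw [h2] at h1
  rw [h1]
  rfl

theorem dMap_smul_of_eq (hp : IsUniversalCovering d p Γ) {s s' : X → Op m} {γ : Γ}
    (h : ∀ x, s (γ • x) = s' x) {x : X}
    (hs : MDifferentiableAt (𝓡 d) 𝓘(ℝ, Op m) s (γ • x)) (u : TangentSpace (𝓡 d) x) :
    dMap d s (γ • x) (mfderiv (𝓡 d) (𝓡 d) (fun y : X => γ • y) x u) = dMap d s' x u := by
  have h1 := mfderiv_comp x hs (hp.mdifferentiableAt_smul γ x)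
  have h2 : s ∘ (fun y : X => γ • y) = s' := funext h
  rw [h2] at h1
  rw [dMap, dMap, h1]
  rfl

variable [RiemannianBundle (fun x : M => TangentSpace (𝓡 d) x)]

/-- Both sums lift the same orthonormal basis, the one chosen at `p (γ • x) = p x`, and `dγ` carries
one lift to the other. -/
theorem frameSum_smul (hp : IsUniversalCovering d p Γ) {A : Type*} [AddCommMonoid A] (γ : Γ)
    (x : X) {b' : TangentSpace (𝓡 d) (γ • x) → A} {b : TangentSpace (𝓡 d) x → A}
    (h : ∀ u, b' (mfderiv (𝓡 d) (𝓡 d) (fun y : X => γ • y) x u) = b u) :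
    frameSum (d := d) p (γ • x) b' = frameSum (d := d) p x b := by
  -- Values in the fixed model space allow the base point `p (γ • x)` to be replaced by `p x`.
  let vec : M → Fin (Module.finrank ℝ (EuclideanSpace ℝ (Fin d))) → EuclideanSpace ℝ (Fin d) :=
    fun y j =>
      haveI : FiniteDimensional ℝ (TangentSpace (𝓡 d) y) :=
        inferInstanceAs (FiniteDimensional ℝ (EuclideanSpace ℝ (Fin d)))
      stdOrthonormalBasis ℝ (TangentSpace (𝓡 d) y) j
  have h1 : frameSum (d := d) p (γ • x) b'
      = ∑ j, b' ((mfderiv (𝓡 d) (𝓡 d) p (γ • x)).inverse (vec (p (γ • x)) j)) := rfl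
  have h2 : frameSum (d := d) p x b
      = ∑ j, b ((mfderiv (𝓡 d) (𝓡 d) p x).inverse (vec (p x) j)) := rfl
  rw [h1, h2, hp.map_smul γ x]
  refine Finset.sum_congr rfl fun j _ => ?_
  rw [← h]
  congr 1
  let D := (hp.localDiffeo x).mfderivToContinuousLinearEquiv (by simp)
  let D' := (hp.localDiffeo (γ • x)).mfderivToContinuousLinearEquiv (by simp)
  have e1 : (mfderiv (𝓡 d) (𝓡 d) p x).inverse = D.symm := ContinuousLinearMap.inverse_equiv D
  have e2 : (mfderiv (𝓡 d) (𝓡 d) p (γ • x)).inverse = D'.symm :=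
    ContinuousLinearMap.inverse_equiv D'
  rw [e1]
  refine (DFunLike.congr_fun e2 (vec (p x) j)).trans (D'.symm_apply_eq.2 ?_)
  refine Eq.trans ?_ (hp.mfderiv_comp_smul γ x (D.symm (vec (p x) j))).symm
  exact (D.apply_symm_apply (vec (p x) j)).symm

end Deck

/-! ### Invariant functions on the covering as functions on `M`. -/

section Descend

variable {d : ℕ} {X M Γ : Type*} [TopologicalSpace X]
  [ChartedSpace (EuclideanSpace ℝ (Fin d)) X] [TopologicalSpace M]
  [ChartedSpace (EuclideanSpace ℝ (Fin d)) M] [Group Γ] [MulAction Γ X] {p : X → M}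

theorem IsUniversalCovering.descend_apply (hp : IsUniversalCovering d p Γ) {u : X → ℝ}
    (hu : ∀ (γ : Γ) (x : X), u (γ • x) = u x) (x : X) : descend p u (p x) = u x := by
  have h : ∃ x', p x' = p x := ⟨x, rfl⟩
  rw [descend, dif_pos h]
  obtain ⟨γ, hγ, -⟩ := hp.simplyTransitive x h.choose h.choose_spec.symm
  rw [← hu γ x, hγ]

theorem IsUniversalCovering.continuous_descend (hp : IsUniversalCovering d p Γ) {u : X → ℝ}
    (hu : ∀ (γ : Γ) (x : X), u (γ • x) = u x) (hc : Continuous u) :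
    Continuous (descend p u) := by
  have hq : Topology.IsQuotientMap p := hp.localDiffeo.isOpenMap.isQuotientMap
    hp.localDiffeo.contMDiff.continuous hp.surjective
  rw [hq.continuous_iff]
  exact hc.congr fun x => (hp.descend_apply hu x).symm

end Descend

/-! ### The action of `G` on the geometric data of `N` -/

section Action

variable {m : ℕ} {G : Subgroup (Op m)ˣ} (g : (Op m)ˣ) (n : (Op m)ˣ)

theorem inverse_conj : Ring.inverse ((g : Op m) * (n : Op m) * star (g : Op m))
    = star ((g⁻¹ : (Op m)ˣ) : Op m) * ((n⁻¹ : (Op m)ˣ) : Op m) * ((g⁻¹ : (Op m)ˣ) : Op m) := by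
  have h : (g : Op m) * n * star (g : Op m) = ((g * n * star g : (Op m)ˣ) : Op m) := by simp
  rw [h, Ring.inverse_unit, mul_inv_rev, mul_inv_rev]
  simp only [Units.val_mul, ← star_inv, Units.coe_star, mul_assoc]

theorem star_mul_star_inv_mul (z : Op m) :
    star (g : Op m) * (star ((g⁻¹ : (Op m)ˣ) : Op m) * z) = z := by
  rw [← mul_assoc, ← star_mul, Units.inv_mul, star_one, one_mul]

theorem adjAt_conj (ξ : Op m) :
    adjAt ((g : Op m) * (n : Op m) * star (g : Op m)) (Ad g ξ) = Ad g (adjAt (n : Op m) ξ) := by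
  rw [adjAt, inverse_conj, adjAt_unit, Ad, Ad, star_mul, star_mul]
  simp only [mul_assoc, star_mul_star_inv_mul]

theorem projP_conj (ξ : Op m) :
    projP ((g : Op m) * (n : Op m) * star (g : Op m)) (Ad g ξ) = Ad g (projP (n : Op m) ξ) := by
  rw [projP, projP, adjAt_conj]
  simp only [Ad, mul_add, add_mul, mul_smul_comm, smul_mul_assoc, smul_add]

theorem betaN_conj (V : Op m) :
    betaN ((g : Op m) * (n : Op m) * star (g : Op m)) ((g : Op m) * V * star (g : Op m))
      = Ad g (betaN (n : Op m) V) := by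
  rw [betaN, betaN, inverse_conj, Ring.inverse_unit]
  simp only [Ad, mul_assoc, star_mul_star_inv_mul, mul_smul_comm, smul_mul_assoc]

variable {B : LinearMap.BilinForm ℝ (Op m)}

theorem metricAt_conj {g : (Op m)ˣ} (hG : IsReductiveLinear G) (hB : IsInvariantForm G B)
    (hg : g ∈ G) {n : Op m} (hn : n ∈ symSpace G) {ξ η : Op m} (hξ : ξ ∈ lieAlg G) (hη : η ∈ lieAlg G) :
    metricAt B ((g : Op m) * (n : Op m) * star (g : Op m)) (Ad g ξ) (Ad g η) = metricAt B n ξ η := by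
  obtain ⟨u, rfl, -⟩ := exists_unit_of_mem_symSpace hn
  rw [metricAt, metricAt, adjAt_conj]
  exact hB.invariant g hg _ hξ _ (adjAt_mem hG hn hη)

end Action

/-! ### The Riemannian volume -/

theorem chartPartition_subordinate {d : ℕ} {M : Type*} [TopologicalSpace M]
    [ChartedSpace (EuclideanSpace ℝ (Fin d)) M] [IsManifold (𝓡 d) ∞ M] [T2Space M]
    [SigmaCompactSpace M] (i : M) :
    tsupport (chartPartition d M i) ⊆ (chartAt (EuclideanSpace ℝ (Fin d)) i).source :=
  Classical.choose_spec
    (SmoothPartitionOfUnity.exists_isSubordinate_chartAt_source (𝓡 d) M) i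

section Volume

variable {d : ℕ} {M : Type*} [TopologicalSpace M] [ChartedSpace (EuclideanSpace ℝ (Fin d)) M]
  [IsManifold (𝓡 d) ∞ M] [RiemannianBundle (fun x : M => TangentSpace (𝓡 d) x)]

theorem chartDensity_pos (i : M) {y : EuclideanSpace ℝ (Fin d)}
    (hy : y ∈ (extChartAt (𝓡 d) i).target) : 0 < chartDensity (d := d) i y := by
  have : IsManifold (𝓡 d) 1 M := IsManifold.of_le (n := ∞) (by simp)
  have h1 := isInvertible_mfderivWithin_extChartAt_symm (I := 𝓡 d) hy
  rw [ModelWithCorners.Boundaryless.range_eq_univ, mfderivWithin_univ] at h1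
  obtain ⟨D, hD⟩ := h1
  let e : Module.Basis (Fin d) ℝ (TangentSpace 𝓘(ℝ, EuclideanSpace ℝ (Fin d)) y) :=
    (EuclideanSpace.basisFun (Fin d) ℝ).toBasis
  have h2 := (Matrix.posDef_gram_iff_linearIndependent (𝕜 := ℝ)
    (E := TangentSpace (𝓡 d) ((extChartAt (𝓡 d) i).symm y))).2
    (e.map D.toLinearEquiv).linearIndependent
  refine Real.sqrt_pos.2 (lt_of_lt_of_eq h2.det_pos (congrArg Matrix.det ?_))
  ext a b
  have h3 : ∀ a, mfderiv 𝓘(ℝ, EuclideanSpace ℝ (Fin d)) (𝓡 d) (extChartAt (𝓡 d) i).symm y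
      (EuclideanSpace.single a (1 : ℝ) : EuclideanSpace ℝ (Fin d)) = e.map D.toLinearEquiv a := by
    intro a
    have he : (EuclideanSpace.basisFun (Fin d) ℝ).toBasis a = EuclideanSpace.single a (1 : ℝ) := by
      simp
    rw [← hD, ← he]
    exact (Module.Basis.map_apply e D.toLinearEquiv a).symm
  rw [Matrix.gram_apply, ← h3, ← h3]
  rfl

theorem continuousOn_chartDensity [IsContMDiffRiemannianBundle (𝓡 d) ∞
    (EuclideanSpace ℝ (Fin d)) (fun x : M => TangentSpace (𝓡 d) x)] (i : M) :
    ContinuousOn (chartDensity (d := d) i) (extChartAt (𝓡 d) i).target := by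
  have : IsManifold (𝓡 d) 1 M := IsManifold.of_le (n := ∞) (by simp)
  have : IsContMDiffRiemannianBundle (𝓡 d) 0 (EuclideanSpace ℝ (Fin d))
      (fun x : M => TangentSpace (𝓡 d) x) := IsContMDiffRiemannianBundle.of_le (n := ∞) (by simp)
  let σ := (extChartAt (𝓡 d) i).symm
  have ho : IsOpen (extChartAt (𝓡 d) i).target := isOpen_extChartAt_target i
  have h1 := (contMDiffOn_extChartAt_symm (I := 𝓡 d) (n := ∞) i).contMDiffOn_tangentMapWithin
    (m := 0) (by simp) ho.uniqueMDiffOn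
  have h2 : ∀ v : EuclideanSpace ℝ (Fin d), ContMDiffOn 𝓘(ℝ, EuclideanSpace ℝ (Fin d))
      ((𝓡 d).tangent) 0 (fun y => (⟨σ y, mfderiv 𝓘(ℝ, EuclideanSpace ℝ (Fin d)) (𝓡 d) σ y v⟩ :
        TangentBundle (𝓡 d) M)) (extChartAt (𝓡 d) i).target := by
    intro v
    have h3 : ContMDiffOn 𝓘(ℝ, EuclideanSpace ℝ (Fin d))
        (𝓘(ℝ, EuclideanSpace ℝ (Fin d)).tangent) 0 (fun y =>
        (⟨y, v⟩ : TangentBundle 𝓘(ℝ, EuclideanSpace ℝ (Fin d)) (EuclideanSpace ℝ (Fin d))))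
        (extChartAt (𝓡 d) i).target := by
      refine contMDiffOn_vectorSpace_iff_contDiffOn.2 contDiffOn_const
    have h4 := h1.comp h3 (fun y hy => hy)
    refine h4.congr fun y hy => ?_
    simp only [Function.comp_apply, tangentMapWithin]
    rw [mfderivWithin_of_mem_nhds (ho.mem_nhds hy)]
  refine ContinuousOn.sqrt ?_
  refine ContinuousOn.comp (g := Matrix.det) (t := Set.univ)
    (Continuous.matrix_det continuous_id).continuousOn ?_ (Set.mapsTo_univ _ _)
  refine continuousOn_pi.2 fun a => continuousOn_pi.2 fun b => ?_
  have h5 := ContMDiffOn.inner_bundle (IB := 𝓡 d) (F := EuclideanSpace ℝ (Fin d))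
    (E := fun x : M => TangentSpace (𝓡 d) x) (b := σ) (h2 (EuclideanSpace.single a (1 : ℝ)))
    (h2 (EuclideanSpace.single b (1 : ℝ)))
  exact h5.continuousOn

variable [T2Space M] [CompactSpace M] [MeasurableSpace M] [BorelSpace M]
  [IsContMDiffRiemannianBundle (𝓡 d) ∞
    (EuclideanSpace ℝ (Fin d)) (fun x : M => TangentSpace (𝓡 d) x)]

open MeasureTheory in
instance isFiniteMeasure_riemannianVolume : IsFiniteMeasure (riemannianVolume d M) := by
  let ν : M → Measure M := fun i => Measure.map (extChartAt (𝓡 d) i).symm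
      ((volume.restrict (extChartAt (𝓡 d) i).target).withDensity fun y =>
        ENNReal.ofReal
          (chartPartition d M i ((extChartAt (𝓡 d) i).symm y) * chartDensity i y))
  have hν : riemannianVolume d M = Measure.sum ν := rfl
  -- By local finiteness and compactness only finitely many charts contribute to the sum of
  -- measures.
  have hfin : {i : M | (Function.support (chartPartition d M i)).Nonempty}.Finite :=
    (chartPartition d M).locallyFinite'.finite_nonempty_of_compact
  have hzero : ∀ i, i ∉ hfin.toFinset → ν i Set.univ = 0 := by
    intro i hi
    have h0 : ∀ x, chartPartition d M i x = 0 := by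
      simpa [Set.not_nonempty_iff_eq_empty, Function.support_eq_empty_iff, funext_iff] using hi
    simp [ν, h0]
  have hlt : ∀ i, ν i Set.univ < ⊤ := by
    intro i
    let φ := extChartAt (𝓡 d) i
    let K := φ '' tsupport (chartPartition d M i)
    have hsub : tsupport (chartPartition d M i) ⊆ φ.source := by
      rw [extChartAt_source]; exact chartPartition_subordinate i
    have hK : IsCompact K := (isClosed_tsupport _).isCompact.image_of_continuousOn
      ((continuousOn_extChartAt (I := 𝓡 d) i).mono hsub)
    have hKt : K ⊆ φ.target := by
      rintro _ ⟨x, hx, rfl⟩; exact φ.map_source (hsub hx)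
    obtain ⟨C, hC⟩ := hK.exists_bound_of_continuousOn
      ((continuousOn_chartDensity (d := d) i).mono hKt)
    let δ : EuclideanSpace ℝ (Fin d) → ENNReal := fun y => ENNReal.ofReal
      (chartPartition d M i (φ.symm y) * chartDensity i y)
    -- The chart domain may have infinite volume, but the density lives on the compact image `K` of
    -- the support, where it is bounded.
    have hb : ∀ y ∈ φ.target, δ y ≤ K.indicator (fun _ => ENNReal.ofReal C) y := by
      intro y hy
      by_cases hyK : y ∈ K
      · rw [Set.indicator_of_mem hyK]
        refine ENNReal.ofReal_le_ofReal ?_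
        refine le_trans (mul_le_of_le_one_left (chartDensity_pos i hy).le
          ((chartPartition d M).le_one i _)) ?_
        exact (le_abs_self _).trans (hC y hyK)
      · have : chartPartition d M i (φ.symm y) = 0 := by
          refine image_eq_zero_of_notMem_tsupport fun h => hyK ?_
          exact ⟨_, h, φ.right_inv hy⟩
        simp [δ, this]
    have hm : MeasurableSet φ.target := (isOpen_extChartAt_target i).measurableSet
    have h1 : ((volume.restrict φ.target).withDensity δ) Set.univ < ⊤ := by
      rw [withDensity_apply _ MeasurableSet.univ, Measure.restrict_univ]
      refine lt_of_le_of_lt (setLIntegral_mono' hm hb) ?_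
      refine lt_of_le_of_lt (setLIntegral_le_lintegral _ _) ?_
      rw [lintegral_indicator_const hK.measurableSet]
      exact ENNReal.mul_lt_top ENNReal.ofReal_lt_top hK.measure_lt_top
    have : IsFiniteMeasure ((volume.restrict φ.target).withDensity δ) := ⟨h1⟩
    exact measure_lt_top (Measure.map φ.symm ((volume.restrict φ.target).withDensity δ)) _
  refine ⟨?_⟩
  rw [hν, Measure.sum_apply _ MeasurableSet.univ, tsum_eq_sum hzero]
  exact ENNReal.sum_lt_top.2 fun i _ => hlt i

open MeasureTheory in
instance isOpenPosMeasure_riemannianVolume : (riemannianVolume d M).IsOpenPosMeasure := by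
  refine ⟨fun U hU hne => ?_⟩
  obtain ⟨x, hx⟩ := hne
  obtain ⟨i, hi⟩ : ∃ i, 0 < chartPartition d M i x :=
    (chartPartition d M).exists_pos_of_mem (Set.mem_univ x)
  let φ := extChartAt (𝓡 d) i
  have hxs : x ∈ φ.source := by
    rw [extChartAt_source]
    exact chartPartition_subordinate i (subset_tsupport _ hi.ne')
  let δ : EuclideanSpace ℝ (Fin d) → ℝ := fun y =>
      (chartPartition d M i (φ.symm y) * chartDensity i y)
  have hm : IsOpen φ.target := isOpen_extChartAt_target i
  have hσ : ContinuousOn φ.symm φ.target := continuousOn_extChartAt_symm i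
  have hδ : ContinuousOn δ φ.target :=
    ((chartPartition d M i).contMDiff.continuous.comp_continuousOn hσ).mul
      (continuousOn_chartDensity i)
  have hxt : φ x ∈ φ.target := φ.map_source hxs
  have hpos : 0 < δ (φ x) := by
    refine mul_pos ?_ (chartDensity_pos i hxt)
    rwa [φ.left_inv hxs]
  -- On the open set `W` the density exceeds the constant `c > 0`, so one chart alone already gives
  -- `U` positive measure.
  obtain ⟨c, hc0, hc⟩ := exists_between hpos
  let W := (φ.target ∩ φ.symm ⁻¹' U) ∩ (φ.target ∩ δ ⁻¹' Set.Ioi c)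
  have hW : IsOpen W := (hσ.isOpen_inter_preimage hm hU).inter
    (hδ.isOpen_inter_preimage hm isOpen_Ioi)
  have hxW : φ x ∈ W := ⟨⟨hxt, by simpa [φ.left_inv hxs] using hx⟩, hxt, hc⟩
  let ν := (volume.restrict φ.target).withDensity fun y => ENNReal.ofReal (δ y)
  have hmeas : AEMeasurable φ.symm ν :=
    (hσ.aemeasurable hm.measurableSet).mono_ac (withDensity_absolutelyContinuous _ _)
  have h1 : 0 < ν W := by
    rw [withDensity_apply _ hW.measurableSet]
    refine lt_of_lt_of_le ?_ (setLIntegral_mono' (f := fun _ => ENNReal.ofReal c)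
      hW.measurableSet fun y hy => ENNReal.ofReal_le_ofReal (le_of_lt hy.2.2))
    rw [setLIntegral_const, Measure.restrict_apply hW.measurableSet,
      Set.inter_eq_left.2 fun y hy => hy.1.1]
    exact ENNReal.mul_pos (by simpa using hc0) (hW.measure_pos volume ⟨_, hxW⟩).ne'
  have h2 : 0 < Measure.map φ.symm ν U := by
    rw [Measure.map_apply_of_aemeasurable hmeas hU.measurableSet]
    exact h1.trans_le (measure_mono fun y hy => hy.1.2)
  exact (h2.trans_le (Measure.le_sum_apply _ _ |>.trans' (le_trans
    (ENNReal.le_tsum (f := fun j => Measure.map (extChartAt (𝓡 d) j).symm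
      ((volume.restrict (extChartAt (𝓡 d) j).target).withDensity fun y =>
        ENNReal.ofReal
          (chartPartition d M j ((extChartAt (𝓡 d) j).symm y) * chartDensity j y)) U) i)
    le_rfl))).ne'

end Volume

/-! ### Unfolding integrals over the universal covering -/

section Calculus

variable {d m : ℕ} {X : Type*} [TopologicalSpace X] [ChartedSpace (EuclideanSpace ℝ (Fin d)) X]

theorem HasDirDeriv.sum {ι : Type*} (t : Finset ι) {s : ι → X → Op m} {x : X}
    {u : TangentSpace (𝓡 d) x} {s' : ι → Op m} (h : ∀ i ∈ t, HasDirDeriv (s i) x u (s' i)) :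
    HasDirDeriv (fun y => ∑ i ∈ t, s i y) x u (∑ i ∈ t, s' i) := by
  classical
  induction t using Finset.induction_on with
  | empty =>
    simp only [Finset.sum_empty]
    exact ⟨0, hasMFDerivAt_const _ _, rfl⟩
  | insert a t ha ih =>
    simp only [Finset.sum_insert ha]
    exact (h a (Finset.mem_insert_self a t)).add
      (ih fun i hi => h i (Finset.mem_insert_of_mem hi))

theorem dMap_congr {s s' : X → Op m} {x : X} (h : s =ᶠ[𝓝 x] s') : dMap d s x = dMap d s' x :=
  h.mfderiv_eq

theorem dMap_of_eventually_zero {s : X → Op m} {x : X} (h : s =ᶠ[𝓝 x] fun _ => 0) :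
    dMap d s x = 0 := by
  rw [dMap_congr h, dMap, mfderiv_const]
  rfl

/-- In a chart this is the mean value theorem on a convex ball. -/
theorem isLocallyConstant_of_dMap_eq_zero [IsManifold (𝓡 d) ∞ X] {s : X → Op m}
    (hs : MDifferentiable (𝓡 d) 𝓘(ℝ, Op m) s) (h : ∀ x, dMap d s x = 0) :
    IsLocallyConstant s := by
  have : IsManifold (𝓡 d) 1 X := IsManifold.of_le (n := ∞) (by simp)
  refine (IsLocallyConstant.iff_eventually_eq s).2 fun x => ?_
  let φ := extChartAt (𝓡 d) x
  have ho : IsOpen φ.target := isOpen_extChartAt_target x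
  obtain ⟨r, hr, hrφ⟩ := Metric.isOpen_iff.1 ho _ (mem_extChartAt_target (I := 𝓡 d) x)
  have hd : ∀ y ∈ φ.target,
      HasFDerivAt (s ∘ φ.symm) (0 : EuclideanSpace ℝ (Fin d) →L[ℝ] Op m) y := by
    intro y hy
    have h1 : MDifferentiableAt 𝓘(ℝ, EuclideanSpace ℝ (Fin d)) (𝓡 d) φ.symm y :=
      ((contMDiffOn_extChartAt_symm (I := 𝓡 d) (n := ∞) x).contMDiffAt
        (ho.mem_nhds hy)).mdifferentiableAt (by simp)
    have h2 := (hs (φ.symm y)).hasMFDerivAt.comp y h1.hasMFDerivAt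
    have h3 : mfderiv (𝓡 d) 𝓘(ℝ, Op m) s (φ.symm y) = 0 := h _
    rw [h3] at h2
    exact hasMFDerivAt_iff_hasFDerivAt.1 h2
  have hconst : ∀ y ∈ Metric.ball (φ x) r, s (φ.symm y) = s x := by
    intro y hy
    have h1 := (convex_ball (φ x) r).is_const_of_fderivWithin_eq_zero (𝕜 := ℝ)
      (f := s ∘ φ.symm)
      (fun z hz => (hd z (hrφ hz)).differentiableAt.differentiableWithinAt)
      (fun z hz => by
        rw [fderivWithin_of_isOpen Metric.isOpen_ball hz, (hd z (hrφ hz)).fderiv])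
      hy (Metric.mem_ball_self hr)
    have h2 : φ.symm (φ x) = x := extChartAt_to_inv (I := 𝓡 d) x
    simpa [h2] using h1
  filter_upwards [(continuousAt_extChartAt (I := 𝓡 d) x).preimage_mem_nhds
    (Metric.ball_mem_nhds _ hr), (isOpen_extChartAt_source (I := 𝓡 d) x).mem_nhds
    (mem_extChartAt_source (I := 𝓡 d) x)] with y hy hys
  have h3 := hconst _ hy
  rwa [φ.left_inv hys] at h3

end Calculus

section Linear

variable {m : ℕ} {B : LinearMap.BilinForm ℝ (Op m)}

theorem metricAt_zero (n ξ : Op m) : metricAt B n ξ 0 = 0 := by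
  simp [metricAt, adjAt]

theorem metricAt_add_right (n ξ η η' : Op m) :
    metricAt B n ξ (η + η') = metricAt B n ξ η + metricAt B n ξ η' := by
  simp [metricAt, adjAt_add]

theorem metricAt_sub_left (n ξ ξ' η : Op m) :
    metricAt B n (ξ - ξ') η = metricAt B n ξ η - metricAt B n ξ' η := by
  simp [metricAt]

theorem metricAt_sum {ι : Type*} (t : Finset ι) (n ξ : Op m) (η : ι → Op m) :
    metricAt B n ξ (∑ i ∈ t, η i) = ∑ i ∈ t, metricAt B n ξ (η i) := by
  classical
  induction t using Finset.induction_on with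
  | empty => simp [metricAt_zero]
  | insert a t ha ih => rw [Finset.sum_insert ha, Finset.sum_insert ha, metricAt_add_right, ih]

end Linear

section Unfold

variable {d m : ℕ} {X M Γ : Type*}
  [TopologicalSpace M] [ChartedSpace (EuclideanSpace ℝ (Fin d)) M]
  [TopologicalSpace X] [ChartedSpace (EuclideanSpace ℝ (Fin d)) X]
  [Group Γ] [MulAction Γ X] {p : X → M}

/-- Points of one fibre are separated by sheets, points of different fibres by their images. Being
Hausdorff makes the compact supports used below closed. -/
theorem IsUniversalCovering.t2Space [T2Space M] (hp : IsUniversalCovering d p Γ) : T2Space X := by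
  refine ⟨fun x y hxy => ?_⟩
  by_cases h : p x = p y
  · exact hp.covering.isSeparatedMap x y h hxy
  · obtain ⟨U, V, hU, hV, hx, hy, hUV⟩ := t2_separation h
    have hc : Continuous p := hp.localDiffeo.contMDiff.continuous
    exact ⟨p ⁻¹' U, p ⁻¹' V, hU.preimage hc, hV.preimage hc, hx, hy, hUV.preimage p⟩

variable [RiemannianBundle (fun x : M => TangentSpace (𝓡 d) x)]

/-- The pairing of a form with the differential of a section. -/
def pairing (B : LinearMap.BilinForm ℝ (Op m)) (p : X → M) (f : X → Op m) (α : OneForm d m X)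
    (s : X → Op m) (x : X) : ℝ :=
  frameSum (d := d) p x fun e => metricAt B (f x) (α x e) (dMap d s x e)

variable {B : LinearMap.BilinForm ℝ (Op m)} {f : X → Op m} {α : OneForm d m X}

theorem pairing_congr {s s' : X → Op m} {x : X} (h : dMap d s x = dMap d s' x) :
    pairing B p f α s x = pairing B p f α s' x := by
  rw [pairing, pairing, h]

theorem pairing_eq_zero {s : X → Op m} {x : X} (h : dMap d s x = 0) :
    pairing B p f α s x = 0 := by
  have h1 : ∀ e, metricAt B (f x) (α x e) (dMap d s x e) = 0 := fun e => by
    rw [h]; exact metricAt_zero _ _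
  simp only [pairing, h1, frameSum, Finset.sum_const_zero]

theorem pairing_sum {ι : Type*} (t : Finset ι) {s : ι → X → Op m} {x : X}
    (hs : ∀ i ∈ t, MDifferentiableAt (𝓡 d) 𝓘(ℝ, Op m) (s i) x) :
    pairing B p f α (fun y => ∑ i ∈ t, s i y) x = ∑ i ∈ t, pairing B p f α (s i) x := by
  have h1 : ∀ e, dMap d (fun y => ∑ i ∈ t, s i y) x e = ∑ i ∈ t, dMap d (s i) x e := fun e =>
    (HasDirDeriv.sum t fun i hi => hasDirDeriv_of_mdifferentiableAt (hs i hi) e).dMap_eq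
  simp only [pairing, h1, metricAt_sum, frameSum]
  exact Finset.sum_comm

/-- A section supported in a sheet over a set on which `ρ` is supported. -/
theorem exists_sheet_section [T2Space M] [CompactSpace M] (hp : IsUniversalCovering d p Γ)
    (Φ : PartialDiffeomorph (𝓡 d) (𝓡 d) X M ∞) (hΦ : Set.EqOn p Φ Φ.source)
    {ρ : M → ℝ} (hρ : tsupport ρ ⊆ Φ.target) {s : X → Op m}
    (hs : ContMDiff (𝓡 d) 𝓘(ℝ, Op m) ∞ s) (hsρ : ∀ x, ρ (p x) = 0 → s x = 0)
    (hinv : ∀ (γ : Γ) (x : X), pairing B p f α s (γ • x) = pairing B p f α s x)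
    {S : Submodule ℝ (Op m)} (hS : ∀ x, s x ∈ S) :
    ∃ φ : X → Op m, ContMDiff (𝓡 d) 𝓘(ℝ, Op m) ∞ φ ∧ (∀ x, φ x ∈ S) ∧ HasCompactSupport φ ∧
      ∀ y, ∑ᶠ x : p ⁻¹' {y}, pairing B p f α φ x = descend p (pairing B p f α s) y := by
  classical
  have := hp.t2Space
  have hpc : Continuous p := hp.localDiffeo.contMDiff.continuous
  -- The cut-off stays smooth: `φ` is supported in the compact lift `K` of `tsupport ρ`, which lies
  -- inside the sheet.
  let φ : X → Op m := fun x => if x ∈ Φ.source then s x else 0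
  let K : Set X := Φ.symm '' tsupport ρ
  have hsymm : ContinuousOn Φ.symm Φ.target := Φ.symm.contMDiffOn.continuousOn
  have hK : IsCompact K := (isClosed_tsupport ρ).isCompact.image_of_continuousOn (hsymm.mono hρ)
  have hKs : K ⊆ Φ.source := by
    rintro _ ⟨y, hy, rfl⟩; exact Φ.toPartialEquiv.map_target (hρ hy)
  have hsupp : Function.support φ ⊆ K := by
    intro x hx
    have hxs : x ∈ Φ.source := by
      by_contra h; exact hx (if_neg h)
    have hφ : φ x = s x := if_pos hxs
    have h1 : ρ (p x) ≠ 0 := fun h => hx (hφ.trans (hsρ x h))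
    refine ⟨p x, subset_tsupport _ h1, ?_⟩
    rw [hΦ hxs]; exact Φ.toPartialEquiv.left_inv hxs
  have htsupp : tsupport φ ⊆ K := closure_minimal hsupp hK.isClosed
  have heq : ∀ x ∈ Φ.source, φ =ᶠ[𝓝 x] s := fun x hx => by
    filter_upwards [Φ.open_source.mem_nhds hx] with z hz using if_pos hz
  have hout : ∀ x, x ∉ Φ.source → pairing B p f α φ x = 0 := fun x hx =>
    pairing_eq_zero (dMap_of_eventually_zero
      (notMem_tsupport_iff_eventuallyEq.1 fun h => hx (hKs (htsupp h))))
  refine ⟨φ, contMDiff_of_tsupport fun x hx => ?_, fun x => ?_,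
    HasCompactSupport.of_support_subset_isCompact hK hsupp, fun y => ?_⟩
  · exact hs.contMDiffAt.congr_of_eventuallyEq (heq x (hKs (htsupp hx)))
  · by_cases h : x ∈ Φ.source
    · simpa [φ, h] using hS x
    · simp [φ, h]
  · by_cases hy : y ∈ Φ.target
    · have hx0 : Φ.symm y ∈ Φ.source := Φ.toPartialEquiv.map_target hy
      have hpx0 : p (Φ.symm y) = y := by rw [hΦ hx0]; exact Φ.toPartialEquiv.right_inv hy
      -- A fibre meets the sheet only once, so a single term survives, and there `φ` agrees with `s`
      -- near the point.
      rw [finsum_eq_single _ (⟨Φ.symm y, hpx0⟩ : p ⁻¹' {y})]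
      · rw [pairing_congr (dMap_congr (heq _ hx0)), ← hp.descend_apply hinv, hpx0]
      · rintro ⟨x, hx⟩ hne
        refine hout x fun hxs => hne (Subtype.ext ?_)
        have hx' : Φ x = y := by rw [← hΦ hxs]; exact hx
        simp only [← hx']
        exact (Φ.toPartialEquiv.left_inv hxs).symm
    -- Off the image of the sheet both sides vanish: the fibre misses the sheet, and `s` is zero
    -- near it because `ρ` is.
    · obtain ⟨x, rfl⟩ := hp.surjective y
      rw [hp.descend_apply hinv, finsum_eq_zero_of_forall_eq_zero, pairing_eq_zero]
      · refine dMap_of_eventually_zero ?_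
        filter_upwards [hpc.continuousAt.preimage_mem_nhds
          ((isClosed_tsupport ρ).isOpen_compl.mem_nhds fun h => hy (hρ h))] with z hz
        exact hsρ z (image_eq_zero_of_notMem_tsupport hz)
      · rintro ⟨z, hz⟩
        refine hout z fun hzs => hy ?_
        have hz' : p z = p x := hz
        rw [← hz', hΦ hzs]
        exact Φ.toPartialEquiv.map_source hzs

end Unfold

/-! ### Equivariant forms and partitions of unity subordinate to sheets. -/

section Equivariant

variable {d m : ℕ} {X M Γ : Type*}
  [TopologicalSpace M] [ChartedSpace (EuclideanSpace ℝ (Fin d)) M]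
  [TopologicalSpace X] [ChartedSpace (EuclideanSpace ℝ (Fin d)) X]
  [Group Γ] [MulAction Γ X] {p : X → M} {G : Subgroup (Op m)ˣ}

/-- The form `A` with values in `𝔤` is equivariant along `ρ₀`. -/
def IsEquivariantForm (ρ₀ : Γ →* G) (A : ∀ x : X, TangentSpace (𝓡 d) x → Op m) : Prop :=
  (∀ x u, A x u ∈ lieAlg G) ∧ ∀ (γ : Γ) (x : X) (u : TangentSpace (𝓡 d) x),
    A (γ • x) (mfderiv (𝓡 d) (𝓡 d) (fun y : X => γ • y) x u) = Ad (ρ₀ γ) (A x u)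

/-- The linear map `Ad_g`. -/
def adCLM (g : (Op m)ˣ) : Op m →L[ℝ] Op m :=
  ContinuousLinearMap.mulLeftRight ℝ (Op m) (g : Op m) ((g⁻¹ : (Op m)ˣ) : Op m)

theorem hasDirDeriv_Ad {s : X → Op m} {x : X} {u : TangentSpace (𝓡 d) x} {s' : Op m}
    (h : HasDirDeriv s x u s') (g : (Op m)ˣ) : HasDirDeriv (fun y => Ad g (s y)) x u (Ad g s') :=
  h.comp_hasFDerivAt (adCLM g).hasFDerivAt

theorem isEquivariantForm_dMap (hp : IsUniversalCovering d p Γ) {ρ₀ : Γ →* G} {s : X → Op m}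
    (hs : MDifferentiable (𝓡 d) 𝓘(ℝ, Op m) s) (hS : ∀ x, s x ∈ lieAlg G) {c : Γ → Op m}
    (h : ∀ (γ : Γ) (x : X), s (γ • x) = Ad (ρ₀ γ) (s x) + c γ) :
    IsEquivariantForm ρ₀ fun x u => dMap d s x u := by
  refine ⟨fun x u => dMap_mem hS (hs x) u, fun γ x u => ?_⟩
  refine (dMap_smul_of_eq hp (h γ) (hs _) u).trans ?_
  have h1 := (hasDirDeriv_Ad (hasDirDeriv_of_mdifferentiableAt (hs x) u) (ρ₀ γ)).add
    (⟨0, hasMFDerivAt_const _ _, rfl⟩ : HasDirDeriv (fun _ : X => c γ) x u 0)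
  rw [h1.dMap_eq, add_zero]

/-- Compactness gives finitely many sheets whose images cover `M`; finiteness lets sums be exchanged
with integrals. -/
theorem exists_sheet_partition [T2Space M] [CompactSpace M] [IsManifold (𝓡 d) ∞ M]
    (hp : IsUniversalCovering d p Γ) :
    ∃ (t : Finset M) (ρ : t → M → ℝ)
      (Φ : t → PartialDiffeomorph (𝓡 d) (𝓡 d) X M ∞),
      (∀ i, ContMDiff (𝓡 d) 𝓘(ℝ, ℝ) ∞ (ρ i)) ∧ (∀ x, ∑ i, ρ i x = 1) ∧
      (∀ i, tsupport (ρ i) ⊆ (Φ i).target) ∧ ∀ i, Set.EqOn p (Φ i) (Φ i).source := by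
  choose q hq using hp.surjective
  choose Ψ hΨ using fun y => hp.localDiffeo (q y)
  have hmem : ∀ y, y ∈ (Ψ y).target := fun y => by
    have h := (Ψ y).toPartialEquiv.map_source (hΨ y).1
    have h2 : Ψ y (q y) = y := by rw [← (hΨ y).2 (hΨ y).1, hq]
    rwa [h2] at h
  obtain ⟨t, ht⟩ := isCompact_univ.elim_finite_subcover (fun y => (Ψ y).target)
    (fun y => (Ψ y).open_target) fun y _ => Set.mem_iUnion.2 ⟨y, hmem y⟩
  obtain ⟨ρ, hρ⟩ := SmoothPartitionOfUnity.exists_isSubordinate (𝓡 d) isClosed_univ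
    (fun i : t => (Ψ i).target) (fun i => (Ψ i).open_target) (by
      intro y hy
      obtain ⟨i, hi, hyi⟩ := Set.mem_iUnion₂.1 (ht hy)
      exact Set.mem_iUnion.2 ⟨⟨i, hi⟩, hyi⟩)
  refine ⟨t, fun i => ρ i, fun i => Ψ i, fun i => (ρ i).contMDiff, fun x => ?_, hρ,
    fun i => (hΨ i).2⟩
  rw [← finsum_eq_sum_of_fintype]
  exact ρ.sum_eq_one (Set.mem_univ x)

theorem continuous_frameSum_of_isContinuousForm [IsManifold (𝓡 d) ∞ M]
    [RiemannianBundle (fun x : M => TangentSpace (𝓡 d) x)]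
    [IsContMDiffRiemannianBundle (𝓡 d) ∞ (EuclideanSpace ℝ (Fin d))
      (fun x : M => TangentSpace (𝓡 d) x)] [IsManifold (𝓡 d) ∞ X]
    (hp : IsUniversalCovering d p Γ) {f : X → Op m} (hf : IsSmoothToN d G f)
    (B : LinearMap.BilinForm ℝ (Op m)) {A A' : ∀ x : X, TangentSpace (𝓡 d) x → Op m}
    (hA : IsContinuousForm A) (hA' : IsContinuousForm A') :
    Continuous fun x => frameSum (d := d) p x fun u => metricAt B (f x) (A x u) (A' x u) :=
  continuous_frameSum_metricAt hp.localDiffeo B hf.contMDiff.continuous (fun x => by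
    obtain ⟨u, hu, -⟩ := exists_unit_of_mem_symSpace (hf.mem_symSpace x)
    exact ⟨u, hu⟩) hA hA'

variable [RiemannianBundle (fun x : M => TangentSpace (𝓡 d) x)]

theorem frameSum_metricAt_smul (hp : IsUniversalCovering d p Γ) (hG : IsReductiveLinear G)
    {B : LinearMap.BilinForm ℝ (Op m)} (hB : IsInvariantForm G B) {ρ₀ : Γ →* G} {f : X → Op m}
    (hf : ∀ x, f x ∈ symSpace G) (hfρ : ∀ (γ : Γ) (x : X),
      f (γ • x) = ((ρ₀ γ : (Op m)ˣ) : Op m) * f x * star ((ρ₀ γ : (Op m)ˣ) : Op m))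
    {A A' : ∀ x : X, TangentSpace (𝓡 d) x → Op m} (hA : IsEquivariantForm ρ₀ A)
    (hA' : IsEquivariantForm ρ₀ A') (γ : Γ) (x : X) :
    (frameSum (d := d) p (γ • x) fun u => metricAt B (f (γ • x)) (A (γ • x) u) (A' (γ • x) u))
      = frameSum (d := d) p x fun u => metricAt B (f x) (A x u) (A' x u) := by
  refine frameSum_smul hp γ x fun u => ?_
  rw [hA.2, hA'.2, hfρ, metricAt_conj hG hB (ρ₀ γ).2 (hf x) (hA.1 x u) (hA'.1 x u)]

end Equivariant

/-! ### Orthogonality of coclosed and exact equivariant forms. -/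

section Integral

variable {d m : ℕ} {X M Γ : Type*}
  [TopologicalSpace M] [T2Space M] [CompactSpace M]
  [ChartedSpace (EuclideanSpace ℝ (Fin d)) M] [IsManifold (𝓡 d) ∞ M]
  [RiemannianBundle (fun x : M => TangentSpace (𝓡 d) x)]
  [IsContMDiffRiemannianBundle (𝓡 d) ∞ (EuclideanSpace ℝ (Fin d))
    (fun x : M => TangentSpace (𝓡 d) x)]
  [MeasurableSpace M] [BorelSpace M]
  [TopologicalSpace X] [ChartedSpace (EuclideanSpace ℝ (Fin d)) X]
  [Group Γ] [MulAction Γ X] {p : X → M} {G : Subgroup (Op m)ˣ}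

theorem integrable_descend (hp : IsUniversalCovering d p Γ) {u : X → ℝ}
    (hu : ∀ (γ : Γ) (x : X), u (γ • x) = u x) (hc : Continuous u) :
    MeasureTheory.Integrable (descend p u) (riemannianVolume d M) :=
  (hp.continuous_descend hu hc).integrable_of_hasCompactSupport
    (HasCompactSupport.of_compactSpace _)

/-- A coclosed equivariant form is orthogonal to the exact equivariant forms. -/
theorem baseIntegral_pairing_eq_zero [IsManifold (𝓡 d) ∞ X]
    (hp : IsUniversalCovering d p Γ) (hG : IsReductiveLinear G)
    {B : LinearMap.BilinForm ℝ (Op m)} (hB : IsInvariantForm G B) {ρ₀ : Γ →* G} {f : X → Op m}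
    (hf : IsSmoothToN d G f) (hfρ : ∀ (γ : Γ) (x : X),
      f (γ • x) = ((ρ₀ γ : (Op m)ˣ) : Op m) * f x * star ((ρ₀ γ : (Op m)ˣ) : Op m))
    {α : OneForm d m X}
    (hα : IsCodifferential G B p f α 0) (hαc : IsContinuousForm fun x u => α x u)
    (hαe : IsEquivariantForm ρ₀ fun x u => α x u) {s : X → Op m}
    (hs : ContMDiff (𝓡 d) 𝓘(ℝ, Op m) ∞ s) (hsG : ∀ x, s x ∈ lieAlg G)
    (hse : ∀ (γ : Γ) (x : X), s (γ • x) = Ad (ρ₀ γ) (s x)) :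
    baseIntegral d p (pairing B p f α s) = 0 := by
  obtain ⟨ι, ρ, Φ, hρ, hsum, hsub, hΦ⟩ := exists_sheet_partition hp
  have hpc : ContMDiff (𝓡 d) (𝓡 d) ∞ p := hp.localDiffeo.contMDiff
  -- The cut-offs come from `M`, so each piece is still equivariant; its compactly supported
  -- representative on one sheet is an admissible test section for `d^*α = 0`.
  let t : ι → X → Op m := fun i x => ρ i (p x) • s x
  have ht : ∀ i, ContMDiff (𝓡 d) 𝓘(ℝ, Op m) ∞ (t i) := fun i => ((hρ i).comp hpc).smul hs
  have htG : ∀ i x, t i x ∈ lieAlg G := fun i x => (lieAlg G).smul_mem _ (hsG x)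
  have hte : ∀ i (γ : Γ) (x : X), t i (γ • x) = Ad (ρ₀ γ) (t i x) + 0 := fun i γ x => by
    simp only [t, hp.map_smul, hse, Ad, mul_smul_comm, smul_mul_assoc, add_zero]
  have hinv : ∀ i (γ : Γ) (x : X),
      pairing B p f α (t i) (γ • x) = pairing B p f α (t i) x := by
    intro i γ x
    have h1 := isEquivariantForm_dMap (c := fun _ => 0) hp ((ht i).mdifferentiable (by simp))
      (htG i) (hte i)
    have h2 := frameSum_metricAt_smul hp hG hB hf.mem_symSpace hfρ hαe h1 γ x
    exact h2
  have hcont : ∀ i, Continuous (pairing B p f α (t i)) := by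
    intro i
    have h1 := continuous_frameSum_of_isContinuousForm hp hf B hαc (isContinuousForm_dMap (ht i))
    exact h1
  have hzero : ∀ i, ∫ y, descend p (pairing B p f α (t i)) y ∂(riemannianVolume d M) = 0 := by
    intro i
    obtain ⟨φ, hφ, hφG, hφc, hφs⟩ := exists_sheet_section hp (Φ i) (hΦ i) (hsub i) (ht i)
      (fun x hx => by simp [t, hx]) (hinv i) (htG i)
    have h1 := hα φ hφ hφG hφc
    have h2 : coverIntegral d p (fun x => metricAt B (f x) ((0 : X → Op m) x) (φ x)) = 0 := by
      simp [coverIntegral, metricAt]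
    rw [h2] at h1
    simp only [← hφs]
    exact h1
  have hdesc : ∀ y, descend p (pairing B p f α s) y
      = ∑ i, descend p (pairing B p f α (t i)) y := by
    intro y
    obtain ⟨x, rfl⟩ := hp.surjective y
    have h1 : s = fun y => ∑ i, t i y := by
      funext y
      simp only [t, ← Finset.sum_smul, hsum, one_smul]
    have h2 : ∀ x, pairing B p f α s x = ∑ i, pairing B p f α (t i) x := fun x => by
      conv_lhs => rw [h1]
      exact pairing_sum _ fun i _ => (ht i).contMDiffAt.mdifferentiableAt (by simp)
    rw [hp.descend_apply fun γ x => by simp only [h2, hinv], h2]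
    exact Finset.sum_congr rfl fun i _ => (hp.descend_apply (hinv i) x).symm
  rw [baseIntegral]
  simp only [hdesc]
  rw [MeasureTheory.integral_finsetSum _ fun i _ => integrable_descend hp (hinv i) (hcont i)]
  exact Finset.sum_eq_zero fun i _ => hzero i

end Integral

/-! ### Uniqueness of harmonic representatives -/

section Uniqueness

variable {d m : ℕ} {X M Γ : Type*}
  [TopologicalSpace M] [ChartedSpace (EuclideanSpace ℝ (Fin d)) M]
  [TopologicalSpace X] [ChartedSpace (EuclideanSpace ℝ (Fin d)) X]
  [Group Γ] [MulAction Γ X] {p : X → M} {G : Subgroup (Op m)ˣ}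

/-- `x ↦ Φ (γ • x) - Ad (ρ₀ γ) (Φ x)` has zero differential by equivariance of `dΦ`, and `X` is
connected. -/
theorem isEquivariant_primitive [IsManifold (𝓡 d) ∞ X] (hp : IsUniversalCovering d p Γ)
    {ρ₀ : Γ →* G} {Φ : X → Op m} (hΦ : ContMDiff (𝓡 d) 𝓘(ℝ, Op m) ∞ Φ)
    (h : ∀ (γ : Γ) (x : X) (u : TangentSpace (𝓡 d) x),
      dMap d Φ (γ • x) (mfderiv (𝓡 d) (𝓡 d) (fun y : X => γ • y) x u)
        = Ad (ρ₀ γ) (dMap d Φ x u)) (γ : Γ) (x y : X) :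
    Φ (γ • x) - Ad (ρ₀ γ) (Φ x) = Φ (γ • y) - Ad (ρ₀ γ) (Φ y) := by
  have := hp.simplyConnected
  have hd : MDifferentiable (𝓡 d) 𝓘(ℝ, Op m) Φ := hΦ.mdifferentiable (by simp)
  have hd1 : MDifferentiable (𝓡 d) 𝓘(ℝ, Op m) fun x => Φ (γ • x) := fun x =>
    (hd (γ • x)).comp x (hp.mdifferentiableAt_smul γ x)
  have hd2 : MDifferentiable (𝓡 d) 𝓘(ℝ, Op m) fun x => Ad (ρ₀ γ) (Φ x) := fun x =>
    (adCLM (ρ₀ γ : (Op m)ˣ)).mdifferentiableAt.comp x (hd x)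
  have hc : IsLocallyConstant fun x => Φ (γ • x) - Ad (ρ₀ γ) (Φ x) := by
    refine isLocallyConstant_of_dMap_eq_zero (d := d) (fun x => (hd1 x).sub (hd2 x)) fun x => ?_
    ext1 u
    have h1 := (hasDirDeriv_of_mdifferentiableAt (hd1 x) u).sub
      (hasDirDeriv_Ad (hasDirDeriv_of_mdifferentiableAt (hd x) u) (ρ₀ γ))
    rw [h1.dMap_eq, ← h, dMap_smul_of_eq hp (fun _ => rfl) (hd _), sub_self]
    rfl
  exact hc.apply_eq_of_preconnectedSpace x y

variable [RiemannianBundle (fun x : M => TangentSpace (𝓡 d) x)]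

theorem metricAt_self_nonneg (hG : IsReductiveLinear G) {B : LinearMap.BilinForm ℝ (Op m)}
    (hB : IsInvariantForm G B) {n : Op m} (hn : n ∈ symSpace G) {ξ : Op m} (hξ : ξ ∈ lieAlg G) :
    0 ≤ metricAt B n ξ ξ := by
  by_cases h : ξ = 0
  · rw [h, metricAt_zero]
  · exact (metricAt_pos hG hB hn hξ h).le

theorem eq_zero_of_frameSum_metricAt_eq_zero (hG : IsReductiveLinear G)
    {B : LinearMap.BilinForm ℝ (Op m)} (hB : IsInvariantForm G B) {n : Op m}
    (hn : n ∈ symSpace G) {x : X} (hp : IsLocalDiffeomorphAt (𝓡 d) (𝓡 d) ∞ p x)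
    {A : TangentSpace (𝓡 d) x →L[ℝ] Op m} (hA : ∀ u, A u ∈ lieAlg G)
    (h : (frameSum (d := d) p x fun u => metricAt B n (A u) (A u)) = 0) : A = 0 := by
  have : FiniteDimensional ℝ (TangentSpace (𝓡 d) (p x)) :=
    inferInstanceAs (FiniteDimensional ℝ (EuclideanSpace ℝ (Fin d)))
  let D := hp.mfderivToContinuousLinearEquiv (by simp)
  have hi : (mfderiv (𝓡 d) (𝓡 d) p x).inverse = D.symm := ContinuousLinearMap.inverse_equiv D
  rw [frameSum, Finset.sum_eq_zero_iff_of_nonneg fun j _ => metricAt_self_nonneg hG hB hn (hA _)]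
    at h
  have h1 : ∀ j, A (D.symm (stdOrthonormalBasis ℝ (TangentSpace (𝓡 d) (p x)) j)) = 0 := by
    intro j
    have h2 := h j (Finset.mem_univ j)
    rw [hi] at h2
    by_contra h3
    exact (metricAt_pos hG hB hn (hA _) h3).ne' h2
  let L : TangentSpace (𝓡 d) (p x) →ₗ[ℝ] Op m := A.toLinearMap ∘ₗ D.symm.toLinearEquiv.toLinearMap
  have h4 : L = 0 := (stdOrthonormalBasis ℝ (TangentSpace (𝓡 d) (p x))).toBasis.ext fun j => by
    rw [OrthonormalBasis.coe_toBasis]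
    exact h1 j
  ext1 u
  have h5 := LinearMap.congr_fun h4 (D u)
  have h6 : L (D u) = A u := congrArg A (D.symm_apply_apply u)
  rw [← h6, h5]
  rfl

variable [T2Space M] [CompactSpace M] [IsManifold (𝓡 d) ∞ M]
  [IsContMDiffRiemannianBundle (𝓡 d) ∞ (EuclideanSpace ℝ (Fin d))
    (fun x : M => TangentSpace (𝓡 d) x)]
  [MeasurableSpace M] [BorelSpace M] [IsManifold (𝓡 d) ∞ X]

/-- A harmonic primitive along a cocycle has the harmonic representative as differential. -/
theorem dMap_eq_of_isHarmonicRepresentative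
    (hp : IsUniversalCovering d p Γ) (hG : IsReductiveLinear G)
    {B : LinearMap.BilinForm ℝ (Op m)} (hB : IsInvariantForm G B) {ρ₀ : Γ →* G} {f : X → Op m}
    (hf : IsSmoothToN d G f) (hfρ : ∀ (γ : Γ) (x : X),
      f (γ • x) = ((ρ₀ γ : (Op m)ˣ) : Op m) * f x * star ((ρ₀ γ : (Op m)ˣ) : Op m))
    {c : Γ → Op m} {om : OneForm d m X} (hom : IsHarmonicRepresentative G B p f ρ₀ c om)
    {F : X → Op m} (hF : ContMDiff (𝓡 d) 𝓘(ℝ, Op m) ∞ F) (hFg : ∀ x, F x ∈ lieAlg G)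
    (hFe : ∀ (γ : Γ) (x : X), F (γ • x) = Ad (ρ₀ γ) (F x) + c γ)
    (hFh : IsCodifferential G B p f (dMap d F) 0) : dMap d F = om := by
  have := hp.simplyConnected
  obtain ⟨Φ, hΦ, hΦg, rfl, hper⟩ := hom.represents
  obtain ⟨x₀⟩ : Nonempty X := inferInstance
  obtain ⟨ζ, hζ, hζγ⟩ := hper x₀
  have hdF : MDifferentiable (𝓡 d) 𝓘(ℝ, Op m) F := hF.mdifferentiable (by simp)
  have hdΦ : MDifferentiable (𝓡 d) 𝓘(ℝ, Op m) Φ := hΦ.mdifferentiable (by simp)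
  -- The periods of `Φ` at `x₀` are `c` plus the coboundary of `ζ`. Subtracting `Φ x₀ - ζ` leaves
  -- exactly the cocycle `c`, which cancels against that of `F`.
  let s : X → Op m := fun x => Φ x - F x - (Φ x₀ - ζ)
  have hs : ContMDiff (𝓡 d) 𝓘(ℝ, Op m) ∞ s := (hΦ.sub hF).sub contMDiff_const
  have hsg : ∀ x, s x ∈ lieAlg G := fun x => (lieAlg G).sub_mem
    ((lieAlg G).sub_mem (hΦg x) (hFg x)) ((lieAlg G).sub_mem (hΦg x₀) hζ)
  have hse : ∀ (γ : Γ) (x : X), s (γ • x) = Ad (ρ₀ γ) (s x) := by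
    intro γ x
    have h1 := isEquivariant_primitive hp hΦ hom.equivariant γ x x₀
    have h2 : Φ (γ • x) = Ad (ρ₀ γ) (Φ x) + (Φ (γ • x₀) - Ad (ρ₀ γ) (Φ x₀)) := by
      rw [← h1]; abel
    have h3 : Φ (γ • x₀) = c γ + (Ad (ρ₀ γ) ζ - ζ) + Φ x₀ := eq_add_of_sub_eq (hζγ γ)
    simp only [s, h2, h3, hFe, sub_eq_add_neg, Ad_add, Ad_neg, neg_add, neg_neg]
    abel
  have hds : ∀ x u, dMap d s x u = dMap d Φ x u - dMap d F x u := by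
    intro x u
    have h1 := ((hasDirDeriv_of_mdifferentiableAt (hdΦ x) u).sub
      (hasDirDeriv_of_mdifferentiableAt (hdF x) u)).sub
      (⟨0, hasMFDerivAt_const _ _, rfl⟩ : HasDirDeriv (fun _ : X => Φ x₀ - ζ) x u 0)
    rw [h1.dMap_eq, sub_zero]
  have eΦ : IsEquivariantForm ρ₀ fun x u => dMap d Φ x u :=
    ⟨fun x u => dMap_mem hΦg (hdΦ x) u, hom.equivariant⟩
  have eF : IsEquivariantForm ρ₀ fun x u => dMap d F x u := isEquivariantForm_dMap hp hdF hFg hFe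
  have es : IsEquivariantForm ρ₀ fun x u => dMap d s x u :=
    isEquivariantForm_dMap (c := fun _ => 0) hp (hs.mdifferentiable (by simp)) hsg
      fun γ x => by rw [hse, add_zero]
  have cΦ := isContinuousForm_dMap hΦ
  have cF := isContinuousForm_dMap hF
  have cs := isContinuousForm_dMap hs
  have h1 := baseIntegral_pairing_eq_zero hp hG hB hf hfρ hom.coclosed cΦ eΦ hs hsg hse
  have h2 := baseIntegral_pairing_eq_zero hp hG hB hf hfρ hFh cF eF hs hsg hse
  have inv : ∀ {α : OneForm d m X}, IsEquivariantForm ρ₀ (fun x u => α x u) →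
      ∀ (γ : Γ) (x : X), pairing B p f α s (γ • x) = pairing B p f α s x := by
    intro α hα γ x
    have h := frameSum_metricAt_smul hp hG hB hf.mem_symSpace hfρ hα es γ x
    exact h
  have cont : ∀ {α : OneForm d m X}, IsContinuousForm (fun x u => α x u) →
      Continuous (pairing B p f α s) := by
    intro α hα
    have h := continuous_frameSum_of_isContinuousForm hp hf B hα cs
    exact h
  have hsub : ∀ x, pairing B p f (dMap d s) s x
      = pairing B p f (dMap d Φ) s x - pairing B p f (dMap d F) s x := by
    intro x
    simp only [pairing, frameSum]
    rw [← Finset.sum_sub_distrib]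
    exact Finset.sum_congr rfl fun j _ => by rw [hds, metricAt_sub_left]
  have hdesc : ∀ y, descend p (pairing B p f (dMap d s) s) y
      = descend p (pairing B p f (dMap d Φ) s) y - descend p (pairing B p f (dMap d F) s) y := by
    intro y
    obtain ⟨x, rfl⟩ := hp.surjective y
    rw [hp.descend_apply (inv es), hp.descend_apply (inv eΦ), hp.descend_apply (inv eF), hsub]
  -- `∫ ‖ds‖² = ∫ ⟨ω, ds⟩ - ∫ ⟨dF, ds⟩`, and both terms vanish by orthogonality.
  have hint : ∫ y, descend p (pairing B p f (dMap d s) s) y ∂(riemannianVolume d M) = 0 := by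
    simp only [hdesc]
    rw [MeasureTheory.integral_sub (integrable_descend hp (inv eΦ) (cont cΦ))
      (integrable_descend hp (inv eF) (cont cF))]
    rw [baseIntegral] at h1 h2
    rw [h1, h2, sub_zero]
  have hnn : 0 ≤ descend p (pairing B p f (dMap d s) s) := by
    intro y
    obtain ⟨x, rfl⟩ := hp.surjective y
    rw [hp.descend_apply (inv es)]
    change (0 : ℝ) ≤ pairing B p f (dMap d s) s x
    simp only [pairing, frameSum]
    exact Finset.sum_nonneg fun j _ => metricAt_self_nonneg hG hB (hf.mem_symSpace x) (es.1 x _)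
  rw [MeasureTheory.integral_eq_zero_iff_of_nonneg hnn
    (integrable_descend hp (inv es) (cont cs))] at hint
  -- Almost everywhere becomes everywhere: the function is continuous and the volume charges every
  -- nonempty open set.
  have hz : descend p (pairing B p f (dMap d s) s) = fun _ => (0 : ℝ) :=
    (hp.continuous_descend (inv es) (cont cs)).ae_eq_iff_eq
      (riemannianVolume d M) continuous_const |>.1 hint
  funext x
  have h3 : pairing B p f (dMap d s) s x = 0 :=
    (hp.descend_apply (inv es) x).symm.trans (congrFun hz (p x))
  have h4 : dMap d s x = 0 := eq_zero_of_frameSum_metricAt_eq_zero hG hB (hf.mem_symSpace x)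
    (hp.localDiffeo x) (es.1 x) h3
  ext1 u
  have h5 := hds x u
  rw [h4] at h5
  exact (sub_eq_zero.1 h5.symm).symm

end Uniqueness

/-! ### Invariance and continuity of the second order density -/

section SecondOrder

variable {d m : ℕ} {X M Γ : Type*}
  [TopologicalSpace M] [ChartedSpace (EuclideanSpace ℝ (Fin d)) M]
  [TopologicalSpace X] [ChartedSpace (EuclideanSpace ℝ (Fin d)) X]
  [Group Γ] [MulAction Γ X] {p : X → M} {G : Subgroup (Op m)ˣ} {ρ₀ : Γ →* G} {f : X → Op m}

theorem isEquivariantForm_betaN [IsManifold (𝓡 d) ∞ X] (hp : IsUniversalCovering d p Γ)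
    (hG : IsReductiveLinear G) (hf : IsSmoothToN d G f) (hfρ : ∀ (γ : Γ) (x : X),
      f (γ • x) = ((ρ₀ γ : (Op m)ˣ) : Op m) * f x * star ((ρ₀ γ : (Op m)ˣ) : Op m)) :
    IsEquivariantForm ρ₀ fun x u => betaN (f x) (dMap d f x u) := by
  have hd : MDifferentiable (𝓡 d) 𝓘(ℝ, Op m) f := hf.contMDiff.mdifferentiable (by simp)
  refine ⟨fun x u => ?_, fun γ x u => ?_⟩
  · obtain ⟨β, hβ, -, h⟩ := hf.exists_beta hG x u
    obtain ⟨n, hn, -⟩ := exists_unit_of_mem_symSpace (hf.mem_symSpace x)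
    beta_reduce
    rw [h, ← hn, betaN_two_smul_mul]
    exact hβ
  · obtain ⟨n, hn, -⟩ := exists_unit_of_mem_symSpace (hf.mem_symSpace x)
    have h1 := dMap_smul_of_eq hp (hfρ γ) (hd _) u
    have h2 := ((hasDirDeriv_of_mdifferentiableAt (hd x) u).comp_hasFDerivAt
      (ContinuousLinearMap.mulLeftRight ℝ (Op m) ((ρ₀ γ : (Op m)ˣ) : Op m)
        (star ((ρ₀ γ : (Op m)ˣ) : Op m))).hasFDerivAt).dMap_eq
    have h3 := h1.trans h2
    rw [ContinuousLinearMap.mulLeftRight_apply] at h3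
    beta_reduce
    rw [h3, hfρ, ← hn, betaN_conj]

theorem IsEquivariantForm.projP (hG : IsReductiveLinear G) (hf : ∀ x, f x ∈ symSpace G)
    (hfρ : ∀ (γ : Γ) (x : X),
      f (γ • x) = ((ρ₀ γ : (Op m)ˣ) : Op m) * f x * star ((ρ₀ γ : (Op m)ˣ) : Op m))
    {A : ∀ x : X, TangentSpace (𝓡 d) x → Op m} (hA : IsEquivariantForm ρ₀ A) :
    IsEquivariantForm ρ₀ fun x u => projP (f x) (A x u) := by
  refine ⟨fun x u => projP_mem hG (hf x) (hA.1 x u), fun γ x u => ?_⟩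
  obtain ⟨n, hn, -⟩ := exists_unit_of_mem_symSpace (hf x)
  beta_reduce
  rw [hA.2, hfρ, ← hn, projP_conj]

/-- The term `[c, Ad dF]` in the transformation of `dF₂` cancels `[Ad dF, c]` coming from the
cocycle of `F`; `k` is constant and disappears. -/
theorem isEquivariantForm_psi (hp : IsUniversalCovering d p Γ) {c k : Γ → Op m} {F F₂ : X → Op m}
    (hF : MDifferentiable (𝓡 d) 𝓘(ℝ, Op m) F) (hF₂ : MDifferentiable (𝓡 d) 𝓘(ℝ, Op m) F₂)
    (hFg : ∀ x, F x ∈ lieAlg G) (hF₂g : ∀ x, F₂ x ∈ lieAlg G)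
    (h1 : ∀ (γ : Γ) (x : X), F (γ • x) = Ad (ρ₀ γ) (F x) + c γ)
    (h2 : ∀ (γ : Γ) (x : X),
      F₂ (γ • x) = Ad (ρ₀ γ) (F₂ x) + ⁅c γ, Ad (ρ₀ γ) (F x)⁆ + k γ) :
    IsEquivariantForm ρ₀ fun x u => psi (dMap d F) F F₂ x u := by
  have e := isEquivariantForm_dMap hp hF hFg h1
  refine ⟨fun x u => ?_, fun γ x u => ?_⟩
  · beta_reduce
    rw [psi_apply]
    exact (lieAlg G).add_mem (dMap_mem hF₂g (hF₂ x) u) (lieAlg_bracket G (e.1 x u) (hFg x))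
  · have hc : ∀ z : Op m, HasDirDeriv (fun _ : X => z) x u 0 := fun z =>
      ⟨0, hasMFDerivAt_const _ _, rfl⟩
    have d1 := hasDirDeriv_Ad (hasDirDeriv_of_mdifferentiableAt (hF x) u) (ρ₀ γ)
    have d2 := hasDirDeriv_Ad (hasDirDeriv_of_mdifferentiableAt (hF₂ x) u) (ρ₀ γ)
    have h3 := (dMap_smul_of_eq hp (h2 γ) (hF₂ _) u).trans
      ((d2.add ((hc (c γ)).lie d1)).add (hc (k γ))).dMap_eq
    have e2 := e.2 γ x u
    beta_reduce at e2 ⊢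
    rw [psi_apply, psi_apply, h3, e2, h1, Ad_add, Ad_lie]
    simp only [Ring.lie_def, mul_add, add_mul, zero_mul, mul_zero]
    abel

theorem continuous_inverse_of_mem_symSpace (hc : Continuous f) (hf : ∀ x, f x ∈ symSpace G) :
    Continuous fun x => Ring.inverse (f x) := by
  refine continuous_iff_continuousAt.2 fun x => ?_
  obtain ⟨n, hn, -⟩ := exists_unit_of_mem_symSpace (hf x)
  have h := NormedRing.inverse_continuousAt n
  rw [hn] at h
  exact h.comp hc.continuousAt

variable [IsManifold (𝓡 d) ∞ X] {A : ∀ x : X, TangentSpace (𝓡 d) x → Op m}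

theorem IsContinuousForm.betaN (hc : Continuous f) (hf : ∀ x, f x ∈ symSpace G)
    (hA : IsContinuousForm A) : IsContinuousForm fun x u => betaN (f x) (A x u) := by
  have hi := continuous_inverse_of_mem_symSpace hc hf
  have h := hA.map (T := fun x V => _root_.betaN (f x) V)
    (fun x => ⟨fun V W => by simp only [_root_.betaN, add_mul, smul_add],
      fun a V => by simp only [_root_.betaN, smul_mul_assoc]; rw [smul_comm]⟩)
    (by
      simp only [_root_.betaN]
      exact ((continuous_snd.mul (hi.comp continuous_fst)).const_smul (1 / 2 : ℝ)).continuousOn)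
  exact h

theorem IsContinuousForm.projP (hc : Continuous f) (hf : ∀ x, f x ∈ symSpace G)
    (hA : IsContinuousForm A) : IsContinuousForm fun x u => projP (f x) (A x u) := by
  have hi := continuous_inverse_of_mem_symSpace hc hf
  have h := hA.map (T := fun x V => _root_.projP (f x) V)
    (fun x => ⟨fun V W => projP_add _ _ _, fun a V => projP_smul _ _ _⟩)
    (by
      simp only [_root_.projP, adjAt]
      exact ((continuous_snd.add (((hc.comp continuous_fst).mul continuous_snd.star).mul
        (hi.comp continuous_fst))).const_smul (1 / 2 : ℝ)).continuousOn)
  exact h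

theorem isContinuousForm_psi {F F₂ : X → Op m} (hF : ContMDiff (𝓡 d) 𝓘(ℝ, Op m) ∞ F)
    (hF₂ : ContMDiff (𝓡 d) 𝓘(ℝ, Op m) ∞ F₂) :
    IsContinuousForm fun x u => psi (dMap d F) F F₂ x u := by
  have hFc := hF.continuous
  have h := (isContinuousForm_dMap hF₂).add ((isContinuousForm_dMap hF).map
    (T := fun x V => ⁅V, F x⁆)
    (fun x => ⟨fun V W => by simp only [Ring.lie_def, add_mul, mul_add]; abel,
      fun a V => by simp only [Ring.lie_def, smul_mul_assoc, mul_smul_comm, smul_sub]⟩)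
    (by
      simp only [Ring.lie_def]
      exact ((continuous_snd.mul (hFc.comp continuous_fst)).sub
        ((hFc.comp continuous_fst).mul continuous_snd)).continuousOn))
  exact h

end SecondOrder

theorem iteratedDeriv_two_quadratic (a b c : ℝ) :
    iteratedDeriv 2 (fun t : ℝ => a + t * b + t ^ 2 / 2 * c) 0 = c := by
  have h1 : deriv (fun t : ℝ => a + t * b + t ^ 2 / 2 * c) = fun t => b + t * c := by
    funext t
    have h := (((hasDerivAt_id t).mul_const b).const_add a).add
      ((((hasDerivAt_id t).pow 2).div_const 2).mul_const c)
    refine (h.congr_deriv ?_).deriv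
    simp
  have h2 : HasDerivAt (fun t : ℝ => b + t * c) c 0 := by
    simpa using ((hasDerivAt_id (0 : ℝ)).mul_const c).const_add b
  rw [iteratedDeriv_succ, iteratedDeriv_one, h1, h2.deriv]

end

/-! ### The second derivative of the energy. -/

theorem mainTheorem9 {d m : ℕ} {M X Γ : Type*}
    -- the closed connected Riemannian manifold `M`
    [TopologicalSpace M] [T2Space M] [CompactSpace M] [ConnectedSpace M]
    [ChartedSpace (EuclideanSpace ℝ (Fin d)) M] [IsManifold (𝓡 d) ∞ M]
    [RiemannianBundle (fun x : M => TangentSpace (𝓡 d) x)]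
    [IsContMDiffRiemannianBundle (𝓡 d) ∞ (EuclideanSpace ℝ (Fin d))
      (fun x : M => TangentSpace (𝓡 d) x)]
    [MeasurableSpace M] [BorelSpace M]
    -- its universal covering `p : X → M`, with group `Γ ≅ π₁(M)`
    [TopologicalSpace X] [ChartedSpace (EuclideanSpace ℝ (Fin d)) X] [IsManifold (𝓡 d) ∞ X]
    [Group Γ] [MulAction Γ X] (p : X → M) (hp : IsUniversalCovering d p Γ)
    -- the reductive group `G`, the form defining the metrics, the representation `ρ₀`
    (G : Subgroup (Op m)ˣ) (hG : IsReductiveLinear G)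
    (B : LinearMap.BilinForm ℝ (Op m)) (hB : IsInvariantForm G B) (ρ₀ : Γ →* G)
    -- the harmonic `ρ₀`-equivariant map `f : X → N = G/K`
    (f : X → Op m) (hf : IsHarmonicMap (d := d) G B p f)
    (hfρ : ∀ (γ : Γ) (x : X),
      f (γ • x) = ((ρ₀ γ : (Op m)ˣ) : Op m) * f x * star ((ρ₀ γ : (Op m)ˣ) : Op m))
    -- the second order deformation `ρ₂ = (ρ₀, c, k)` of `ρ₀`, the harmonic form `ω` of class `{c}`
    (ρ₂ : Γ →* jetGroup G) (hρ : ∀ γ : Γ, (ρ₂ γ : JetGL m).base = ρ₀ γ)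
    (om : OneForm d m X)
    (hom : IsHarmonicRepresentative G B p f ρ₀ (fun γ => (ρ₂ γ : JetGL m).fst) om)
    -- the smooth `ρ₂`-equivariant pair `(F, F₂) : X → 𝔤 × 𝔤` of harmonic type
    (F F₂ : X → Op m) (hF : ContMDiff (𝓡 d) 𝓘(ℝ, Op m) ∞ F)
    (hF₂ : ContMDiff (𝓡 d) 𝓘(ℝ, Op m) ∞ F₂)
    (hFg : ∀ x, F x ∈ lieAlg G) (hF₂g : ∀ x, F₂ x ∈ lieAlg G)
    (heq : IsEquivariantPair ρ₂ F F₂) (hht : IsHarmonicType G B p f om F F₂)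
    -- the second order deformation `(v, w)` of `f` induced by `(F, F₂)`
    (v w : X → Op m) (hvw : ∀ x, (v x, w x) = piJN (f x) (F x) (F₂ x)) :
    -- the integrand `⟨ψ, β⟩ + ‖ω^{[𝔭]}‖²`, with `ψ = dF₂ + [ω, F]` and `β = f^*β_N`
    let I : X → ℝ := fun x => frameSum (d := d) p x fun e =>
      metricAt B (f x) (psi om F F₂ x e) (betaN (f x) (dMap d f x e))
        + metricAt B (f x) (projP (f x) (om x e)) (projP (f x) (om x e))
    -- both integrands are invariant and define integrable functions on `M`
    (∀ (γ : Γ) (x : X),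
      secondEnergyDensity (d := d) B p f v w (γ • x) = secondEnergyDensity (d := d) B p f v w x) ∧
    MeasureTheory.Integrable (descend p (secondEnergyDensity (d := d) B p f v w))
      (riemannianVolume d M) ∧
    (∀ (γ : Γ) (x : X), I (γ • x) = I x) ∧
    MeasureTheory.Integrable (descend p I) (riemannianVolume d M) ∧
    iteratedDeriv 2 (deformationEnergy d B p f v w) 0 = baseIntegral d p I := by

  intro I
  have hfs := hf.smooth
  have hsym := hfs.mem_symSpace
  have hF1 : ∀ (γ : Γ) (x : X), F (γ • x) = Ad (ρ₀ γ) (F x) + (ρ₂ γ : JetGL m).fst := by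
    intro γ x
    rw [heq.first, hρ]
  have hF2 : ∀ (γ : Γ) (x : X), F₂ (γ • x) = Ad (ρ₀ γ) (F₂ x)
      + ⁅(ρ₂ γ : JetGL m).fst, Ad (ρ₀ γ) (F x)⁆ + (ρ₂ γ : JetGL m).snd := by
    intro γ x
    rw [heq.second, hρ]
  have hdF : dMap d F = om :=
    dMap_eq_of_isHarmonicRepresentative hp hG hB hfs hfρ hom hF hFg hF1 hht.first
  -- The two densities agree as functions on `X`, so invariance, integrability and the integral are
  -- all settled for `I` alone.
  have hE : secondEnergyDensity (d := d) B p f v w = I := by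
    funext x
    simp only [I, secondEnergyDensity,
      second_density_eq hG hB hfs hF hF₂ hFg hF₂g hdF hvw]
  subst hdF
  have hFd : MDifferentiable (𝓡 d) 𝓘(ℝ, Op m) F := hF.mdifferentiable (by simp)
  have hF₂d : MDifferentiable (𝓡 d) 𝓘(ℝ, Op m) F₂ := hF₂.mdifferentiable (by simp)
  have eψ := isEquivariantForm_psi hp hFd hF₂d hFg hF₂g hF1 hF2
  have eβ := isEquivariantForm_betaN hp hG hfs hfρ
  have eP := (isEquivariantForm_dMap hp hFd hFg hF1).projP hG hsym hfρ
  have cψ := isContinuousForm_psi hF hF₂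
  have cβ := (isContinuousForm_dMap hfs.contMDiff).betaN hfs.contMDiff.continuous hsym
  have cP := (isContinuousForm_dMap hF).projP hfs.contMDiff.continuous hsym
  -- Each summand is now a trace of a pairing of two continuous equivariant forms.
  have hI : I = fun x =>
      (frameSum (d := d) p x fun e =>
        metricAt B (f x) (psi (dMap d F) F F₂ x e) (betaN (f x) (dMap d f x e)))
      + frameSum (d := d) p x fun e =>
        metricAt B (f x) (projP (f x) (dMap d F x e)) (projP (f x) (dMap d F x e)) := by
    funext x
    simp only [I, frameSum, Finset.sum_add_distrib]
  have hinv : ∀ (γ : Γ) (x : X), I (γ • x) = I x := by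
    intro γ x
    have h1 := frameSum_metricAt_smul hp hG hB hsym hfρ eψ eβ γ x
    have h2 := frameSum_metricAt_smul hp hG hB hsym hfρ eP eP γ x
    rw [hI]
    exact congrArg₂ (· + ·) h1 h2
  have hcont : Continuous I := by
    have h1 := continuous_frameSum_of_isContinuousForm hp hfs B cψ cβ
    have h2 := continuous_frameSum_of_isContinuousForm hp hfs B cP cP
    rw [hI]
    exact h1.add h2
  have hint := integrable_descend hp hinv hcont
  rw [hE]
  refine ⟨hinv, hint, hinv, hint, ?_⟩
  have h := iteratedDeriv_two_quadratic
    (1 / 2 * baseIntegral d p (fun x => frameSum (d := d) p x fun e =>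
      metricN B (f x) (dMap d f x e) (dMap d f x e)))
    (baseIntegral d p (fun x => frameSum (d := d) p x fun e =>
      metricN B (f x) (covDeriv (d := d) f v x e) (dMap d f x e)))
    (baseIntegral d p (secondEnergyDensity (d := d) B p f v w))
  rw [hE] at h
  rw [← h, ← hE]
  rfl
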